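/- Let $X,U,Z$ be (real or complex) Hilbert spaces, let $-A$ be the generator of a strongly continuous semigroup $(S(t))_{t\ge 0}$ on $X$, let $X_{-1}$ be the dual of $D(A^*)$ (with the graph norm) with respect to the pivot space $X$, and let $B\in L(U,X_{-1})$ be an admissible control operator, i.e. for some $\tau>0$ and all $u\in L^2(0,\tau;U)$ one has $\int_0^\tau S(\tau-s)Bu(s)\,ds\in X$. For $T>0$, $x_0\in X$ and $u\in L^2(0,T;U)$, a function $x\in C([0,T];X)$ is a solution of $$x'+Ax=Bu,\qquad x(0)=x_0 \tag{1}$$ if $x(t)+\int_0^t Ax(s)\,ds=x_0+\int_0^t Bu(s)\,ds$ in $X_{-1}$ for all $t\in[0,T]$. Let $0<t_0<T$ and let $\Pi:L^2(0,T;X)\to L^2(t_0,T;Z)$ be a linear map (not assumed to be bounded). Assume that (1) is nodal profile exactly controllable with constant $C_1>0$: for all $x_0\in X$ and $z\in L^2(t_0,T;Z)$ there is a control $u\in L^2(0,T;U)$ such that the solution $x$ of (1) satisfies $\Pi x=z$ and $\|u\|_{L^2(0,T;U)}\le C_1\,(\|x_0\|_X+\|z\|_{L^2(t_0,T;Z)})$.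 Let $x_0,x_d\in X$ and $u_d\in U$ (the latter two also regarded as constant functions). For $\gamma>0$ consider the problem $\mathbf S(T,\gamma)$: $$\min_{u\in L^2(0,T;U)}\ \tfrac12\|u-u_d\|^2_{L^2(0,T;U)}+\gamma\,\Big(\int_{t_0}^T\|\Pi x(s)-\Pi x_d(s)\|_Z^2\,ds\Big)^{1/2}\quad\text{subject to (1)}.$$ Let $u_{\rm exact}\in L^2(0,T;U)$ be a control whose state $x_{\rm exact}$, starting at $x_0$, satisfies $\Pi x_{\rm exact}=\Pi x_d$ in $L^2(t_0,T;Z)$, and let $$\gamma>C_1\,\|u_{\rm exact}-u_d\|_{L^2(0,T;U)}$$ (if $u_{\rm exact}=u_d$ on $(t_0,T)$, this norm is $\|u_{\rm exact}-u_d\|_{L^2(0,t_0;U)}$). Then: 1. every solution $(u_T,x_T)$ of $\mathbf S(T,\gamma)$ satisfies $\Pi x_T(s)=\Pi x_d(s)$ for almost every $s\in[t_0,T]$; 2. $\mathbf S(T,\gamma)$ has at most one solution $(u_T,x_T)$; 3. if the control-to-profile map $u\mapsto\Pi x$, where $x$ solves (1) with $x_0=0$, is bounded from $L^2(0,T;U)$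 to $L^2(t_0,T;Z)$ (for instance, if $\Pi$ is bounded), then $\mathbf S(T,\gamma)$ has a solution. -/

import Mathlib

open MeasureTheory Filter Topology
open scoped NNReal

noncomputable section

namespace NodalControl

/-- A strongly continuous semigroup of bounded linear operators on `X`. -/
structure C0Semigroup (𝕜 X : Type*) [RCLike 𝕜] [NormedAddCommGroup X]
    [InnerProductSpace 𝕜 X] where
  toFun : ℝ≥0 → X →L[𝕜] X
  map_zero' : toFun 0 = ContinuousLinearMap.id 𝕜 X
  map_add' : ∀ s t, toFun (s + t) = (toFun s).comp (toFun t)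
  continuous' : ∀ x, Continuous fun t => toFun t x

section Semigroup

variable {𝕜 X : Type*} [RCLike 𝕜] [NormedAddCommGroup X] [InnerProductSpace 𝕜 X]

namespace C0Semigroup

/-- The difference quotient `(S(t) x - x) / t`. -/
def quot (S : C0Semigroup 𝕜 X) (x : X) (t : ℝ≥0) : X :=
  (((t : ℝ) : 𝕜))⁻¹ • (S.toFun t x - x)

/-- `y` is the right derivative at `0` of the orbit of `x`. -/
def HasGen (S : C0Semigroup 𝕜 X) (x y : X) : Prop :=
  Tendsto (S.quot x) (𝓝[>] 0) (𝓝 y)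

theorem HasGen.add {S : C0Semigroup 𝕜 X} {x y x' y' : X} (h : S.HasGen x y)
    (h' : S.HasGen x' y') : S.HasGen (x + x') (y + y') := by
  refine (Tendsto.add h h').congr fun t => ?_
  simp only [quot, map_add, ← smul_add]
  congr 1
  abel

theorem HasGen.smul {S : C0Semigroup 𝕜 X} {x y : X} (c : 𝕜) (h : S.HasGen x y) :
    S.HasGen (c • x) (c • y) := by
  refine (Tendsto.const_smul h c).congr fun t => ?_
  simp only [quot, map_smul, ← smul_sub]
  rw [smul_comm]

theorem HasGen.unique {S : C0Semigroup 𝕜 X} {x y y' : X} (h : S.HasGen x y)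
    (h' : S.HasGen x y') : y = y' :=
  tendsto_nhds_unique h h'

theorem HasGen.flow {S : C0Semigroup 𝕜 X} {x y : X} (h : S.HasGen x y) (t : ℝ≥0) :
    S.HasGen (S.toFun t x) (S.toFun t y) := by
  refine (((S.toFun t).continuous.tendsto y).comp h).congr fun s => ?_
  have h1 : S.toFun t (S.toFun s x) = S.toFun s (S.toFun t x) := by
    have e : S.toFun (t + s) = S.toFun (s + t) := by rw [add_comm]
    rw [S.map_add', S.map_add'] at e
    exact congrArg (fun F : X →L[𝕜] X => F x) e
  simp only [Function.comp, quot, map_smul, map_sub, h1]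

/-- The infinitesimal generator, with its natural domain. -/
def generator (S : C0Semigroup 𝕜 X) : X →ₗ.[𝕜] X where
  domain :=
    { carrier := {x | ∃ y, S.HasGen x y}
      add_mem' := fun ⟨_, h⟩ ⟨_, h'⟩ => ⟨_, h.add h'⟩
      zero_mem' := ⟨0, tendsto_const_nhds.congr fun t => by simp [quot]⟩
      smul_mem' := fun c _ ⟨_, h⟩ => ⟨_, h.smul c⟩ }
  toFun :=
    { toFun := fun x => x.2.choose
      map_add' := fun x x' =>
        (x + x').2.choose_spec.unique (x.2.choose_spec.add x'.2.choose_spec)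
      map_smul' := fun c x => (c • x).2.choose_spec.unique (x.2.choose_spec.smul c) }

/-- The operator `A` of the evolution equation `x' + A x = B u`: the semigroup solves
`x' + A x = 0`, so `A` is the negative of the infinitesimal generator. -/
def A (S : C0Semigroup 𝕜 X) : X →ₗ.[𝕜] X := -S.generator

theorem hasGen_generator (S : C0Semigroup 𝕜 X) (x : S.generator.domain) :
    S.HasGen (x : X) (S.generator x) :=
  Exists.choose_spec (p := fun y => S.HasGen (x : X) y) x.2

theorem mem_graph_A_iff (S : C0Semigroup 𝕜 X) (x y : X) :
    (x, y) ∈ S.A.graph ↔ S.HasGen x (-y) := by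
  rw [LinearPMap.mem_graph_iff]
  constructor
  · rintro ⟨z, hx, hz⟩
    have h := S.hasGen_generator z
    have e : -(S.generator z) = y := hz
    have hx' : (z : X) = x := hx
    rw [← e, neg_neg, ← hx']
    exact h
  · intro h
    refine ⟨⟨x, ⟨-y, h⟩⟩, rfl, ?_⟩
    have h' := S.hasGen_generator ⟨x, ⟨-y, h⟩⟩
    have e : S.generator ⟨x, ⟨-y, h⟩⟩ = -y := h'.unique h
    change -(S.generator ⟨x, ⟨-y, h⟩⟩) = y
    rw [e, neg_neg]

variable [CompleteSpace X]

/-- The space `D(A*)` with the graph norm, realised as the graph of the adjoint `A*`: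
its elements are the pairs `ψ = (ψ, A* ψ)`, normed as elements of `X × X`. -/
abbrev DAdj (S : C0Semigroup 𝕜 X) : Submodule 𝕜 (X × X) := S.A.graph.adjoint

/-- The extrapolation space `X₋₁`, as the (anti)dual of `D(A*)` with pivot space `X`.
An element `x` of `X` is identified with the functional `ψ ↦ ⟨ψ, x⟩`
(the inner product is conjugate linear in its first argument). -/
abbrev Xminus (S : C0Semigroup 𝕜 X) : Type _ := S.DAdj →L⋆[𝕜] 𝕜

/-- The restriction of the adjoint semigroup to `D(A*)`: `(ψ, A* ψ) ↦ (S(t)* ψ, S(t)* A* ψ)`. -/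
def adjFlow (S : C0Semigroup 𝕜 X) (t : ℝ≥0) (ψ : S.DAdj) : S.DAdj :=
  ⟨((S.toFun t).adjoint ψ.1.1, (S.toFun t).adjoint ψ.1.2), by
    rw [Submodule.mem_adjoint_iff]
    intro a b hab
    have h := (Submodule.mem_adjoint_iff _ _).1 ψ.2 (S.toFun t a) (S.toFun t b) (by
      rw [mem_graph_A_iff] at hab ⊢
      simpa using hab.flow t)
    simpa [ContinuousLinearMap.adjoint_inner_right] using h⟩

end C0Semigroup

end Semigroup

section Spaces

/-- The space `L²(a, b; E)`. -/
abbrev L2 (a b : ℝ) (E : Type*) [NormedAddCommGroup E] : Type _ :=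
  Lp E 2 (volume.restrict (Set.Ioc a b))

/-- The class in `L²(a, b; E)` of the constant function `c`. -/
abbrev constL2 (a b : ℝ) {E : Type*} [NormedAddCommGroup E] (c : E) : L2 a b E :=
  Lp.const 2 (volume.restrict (Set.Ioc a b)) c

variable {E : Type*} [NormedAddCommGroup E] {T : ℝ}

open Classical in
/-- Extension of a trajectory in `C([0, T]; E)` by zero to the real line. -/
def ext (x : C(Set.Icc (0 : ℝ) T, E)) (s : ℝ) : E :=
  if h : s ∈ Set.Icc (0 : ℝ) T then x ⟨s, h⟩ else 0

theorem ext_coe (x : C(Set.Icc (0 : ℝ) T, E)) (t : Set.Icc (0 : ℝ) T) : ext x t = x t := by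
  simp only [ext, t.2, dite_true]

theorem continuousOn_ext (x : C(Set.Icc (0 : ℝ) T, E)) :
    ContinuousOn (ext x) (Set.Icc 0 T) := by
  rw [continuousOn_iff_continuous_domRestrict]
  exact x.continuous.congr fun t => (ext_coe x t).symm

theorem norm_ext_le (x : C(Set.Icc (0 : ℝ) T, E)) (s : ℝ) : ‖ext x s‖ ≤ ‖x‖ := by
  unfold ext
  split_ifs with h
  · exact x.norm_coe_le_norm _
  · simp

theorem memLp_ext (x : C(Set.Icc (0 : ℝ) T, E)) :
    MemLp (ext x) 2 (volume.restrict (Set.Ioc 0 T)) := by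
  refine MemLp.of_bound ?_ ‖x‖ (Eventually.of_forall (norm_ext_le x))
  exact ((continuousOn_ext x).aestronglyMeasurable_of_isCompact isCompact_Icc
    measurableSet_Icc).mono_measure (Measure.restrict_mono Set.Ioc_subset_Icc_self le_rfl)

/-- The class in `L²(0, T; E)` of a trajectory in `C([0, T]; E)`. -/
def stateL2 (x : C(Set.Icc (0 : ℝ) T, E)) : L2 0 T E := (memLp_ext x).toLp

end Spaces

section System

variable {𝕜 X U Z : Type*} [RCLike 𝕜]
  [NormedAddCommGroup X] [InnerProductSpace 𝕜 X] [CompleteSpace X]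
  [NormedAddCommGroup U] [InnerProductSpace 𝕜 U]
  [NormedAddCommGroup Z] [InnerProductSpace 𝕜 Z]

/-- `B ∈ L(U, X₋₁)` is an admissible control operator for `S`: for some `τ > 0` the input map
`Φ_τ u = ∫₀^τ S(τ - s) B u(s) ds` (an integral in `X₋₁`) takes its values in `X`. -/
def Admissible (S : C0Semigroup 𝕜 X) (B : U →L[𝕜] S.Xminus) : Prop :=
  ∃ τ : ℝ, 0 < τ ∧ ∀ u : L2 0 τ U, ∃ x : X, ∀ ψ : S.DAdj,
    inner 𝕜 ψ.1.1 x = ∫ s in (0 : ℝ)..τ, B (u s) (S.adjFlow (τ - s).toNNReal ψ)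

/-- `x ∈ C([0, T]; X)` solves `x' + A x = B u` on `[0, T]`, `x(0) = x₀`. The equation holds in
`X₋₁`, in integrated form: `x(t) + ∫₀^t A x ds = x₀ + ∫₀^t B u ds`, tested with `ψ ∈ D(A*)`. -/
def IsSolution (S : C0Semigroup 𝕜 X) (B : U →L[𝕜] S.Xminus) {T : ℝ} (x₀ : X)
    (u : L2 0 T U) (x : C(Set.Icc (0 : ℝ) T, X)) : Prop :=
  ∀ (t : Set.Icc (0 : ℝ) T) (ψ : S.DAdj),
    inner 𝕜 ψ.1.1 (x t) + ∫ s in (0 : ℝ)..t, inner 𝕜 ψ.1.2 (ext x s) =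
      inner 𝕜 ψ.1.1 x₀ + ∫ s in (0 : ℝ)..t, B (u s) ψ

/-- Nodal profile exact controllability in time `t₀` using `L²`-controls, with constant `C₁`. -/
def NodalProfileExactlyControllable (S : C0Semigroup 𝕜 X) (B : U →L[𝕜] S.Xminus) {t₀ T : ℝ}
    (Pi : L2 0 T X →ₗ[𝕜] L2 t₀ T Z) (C₁ : ℝ) : Prop :=
  ∀ (x₀ : X) (z : L2 t₀ T Z), ∃ (u : L2 0 T U) (x : C(Set.Icc (0 : ℝ) T, X)),
    IsSolution S B x₀ u x ∧ Pi (stateL2 x) = z ∧ ‖u‖ ≤ C₁ * (‖x₀‖ + ‖z‖)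

/-- The objective functional of `S(T, γ)`; the tracking norm is not squared. -/
def cost {t₀ T : ℝ} (Pi : L2 0 T X →ₗ[𝕜] L2 t₀ T Z) (γ : ℝ) (x_d : X) (u_d : U)
    (u : L2 0 T U) (x : C(Set.Icc (0 : ℝ) T, X)) : ℝ :=
  1 / 2 * ‖u - constL2 0 T u_d‖ ^ 2 + γ * ‖Pi (stateL2 x) - Pi (constL2 0 T x_d)‖

/-- The control/state pair `p` solves the optimal control problem `S(T, γ)`. -/
def IsOptimal (S : C0Semigroup 𝕜 X) (B : U →L[𝕜] S.Xminus) {t₀ T : ℝ}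
    (Pi : L2 0 T X →ₗ[𝕜] L2 t₀ T Z) (γ : ℝ) (x₀ x_d : X) (u_d : U)
    (p : L2 0 T U × C(Set.Icc (0 : ℝ) T, X)) : Prop :=
  IsSolution S B x₀ p.1 p.2 ∧
    ∀ (v : L2 0 T U) (y : C(Set.Icc (0 : ℝ) T, X)), IsSolution S B x₀ v y →
      cost Pi γ x_d u_d p.1 p.2 ≤ cost Pi γ x_d u_d v y

/-- The control-to-profile map `u ↦ Π x`, where `x' + A x = B u`, `x(0) = 0`, is bounded from
`L²(0, T; U)` to `L²(t₀, T; Z)`. This holds if `Π` is bounded, and for admissible traces. -/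
def ControlToProfileBounded (S : C0Semigroup 𝕜 X) (B : U →L[𝕜] S.Xminus) {t₀ T : ℝ}
    (Pi : L2 0 T X →ₗ[𝕜] L2 t₀ T Z) : Prop :=
  ∃ C : ℝ, ∀ (u : L2 0 T U) (x : C(Set.Icc (0 : ℝ) T, X)),
    IsSolution S B 0 u x → ‖Pi (stateL2 x)‖ ≤ C * ‖u‖

end System

end NodalControl

end

/-! The penalty is exact because its norm is not squared. Let an optimal pair miss the profile by
`e`. Controllability from the zero state gives a control `v` that produces the profile `-e`, with
`‖v‖ ≤ C₁ ‖e‖`. Adding `ε v` lowers the penalty by exactly `ε γ ‖e‖` and raises the quadratic term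
by at most `ε ‖u_T - u_d‖ ‖v‖ + O(ε²)`. Comparison with `u_exact`, whose penalty vanishes, gives
`‖u_T - u_d‖ ≤ ‖u_exact - u_d‖`. Hence `γ ‖e‖ ≤ C₁ ‖u_exact - u_d‖ ‖e‖`, which forces `e = 0`
(`IsOptimal.profile_eq`). Uniqueness of the control is then strict convexity of the Hilbert norm.
For existence, the exact control nearest to `u_d` is shown to be optimal.

The analytic work lies in `Admissible.exists_norm_solution_le`: a solution with zero initial state
satisfies `‖x‖ ≤ R ‖u‖`. It yields uniqueness of the state, and it makes the set of exact controls
closed. It rests on the variation of constants formula tested on `D(A*)`, which needs strong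
continuity of the adjoint semigroup, and on the uniform boundedness principle, which turns
admissibility into an estimate. Well-posedness of (1) is never needed: every state that occurs is
given or comes from controllability, linear combinations or limits. -/

namespace NodalControl

/-! ### Closed linear relations and their adjoints. -/

section Adjoint

variable {𝕜 E F : Type*} [RCLike 𝕜]
  [NormedAddCommGroup E] [InnerProductSpace 𝕜 E] [CompleteSpace E]
  [NormedAddCommGroup F] [InnerProductSpace 𝕜 F] [CompleteSpace F]

/-- A closed linear relation is recovered from its adjoint. -/
theorem mem_of_forall_mem_adjoint {g : Submodule 𝕜 (E × F)} (hg : IsClosed (g : Set (E × F)))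
    {a : E} {b : F}
    (h : ∀ ψ ∈ g.adjoint, inner 𝕜 ψ.1 b - inner 𝕜 ψ.2 a = 0) : (a, b) ∈ g := by
  -- A quarter turn carries `g` to `K = {(d, -c) : (c, d) ∈ g}`, whose orthogonal complement is the
  -- adjoint relation, so the claim becomes `Kᗮᗮ = K`. `WithLp 2` supplies the Hilbert structure
  -- that the sup norm on the product does not have.
  let L : WithLp 2 (F × E) →ₗ[𝕜] E × F :=
    { toFun := fun w => (-w.snd, w.fst)
      map_add' := fun v w => by ext <;> simp [add_comm]
      map_smul' := fun c w => by ext <;> simp }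
  have hL : Continuous L := by
    change Continuous fun w : WithLp 2 (F × E) => (-w.snd, w.fst)
    have hc := WithLp.prod_continuous_ofLp 2 F E
    exact (continuous_snd.comp hc).neg.prodMk (continuous_fst.comp hc)
  let K : Submodule 𝕜 (WithLp 2 (F × E)) := g.comap L
  have hK : IsClosed (K : Set (WithLp 2 (F × E))) := hg.preimage hL
  have : CompleteSpace K := hK.completeSpace_coe
  have hmem : WithLp.toLp 2 (b, -a) ∈ Kᗮᗮ := by
    rw [Submodule.mem_orthogonal]
    intro w hw
    rw [Submodule.mem_orthogonal] at hw
    have hw' : (w.fst, w.snd) ∈ g.adjoint := by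
      rw [Submodule.mem_adjoint_iff]
      intro c d hcd
      have h1 : WithLp.toLp 2 (d, -c) ∈ K := by
        change (-(-c), d) ∈ g
        simpa using hcd
      have h2 := hw _ h1
      rw [WithLp.prod_inner_apply] at h2
      simpa [sub_eq_add_neg] using h2
    have h3 := h _ hw'
    rw [WithLp.prod_inner_apply]
    simpa [sub_eq_add_neg] using h3
  rw [Submodule.orthogonal_orthogonal] at hmem
  have : (-(-a), b) ∈ g := hmem
  simpa using this

end Adjoint

/-! ### The generator: integral characterisation, closed graph, separation of points by `D(A*)`. -/

namespace C0Semigroup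

variable {𝕜 X : Type*} [RCLike 𝕜] [NormedAddCommGroup X] [InnerProductSpace 𝕜 X]
  (S : C0Semigroup 𝕜 X)

theorem continuous_toFun_toNNReal (x : X) : Continuous fun t : ℝ => S.toFun t.toNNReal x :=
  (S.continuous' x).comp continuous_real_toNNReal

theorem toFun_add_toNNReal {s t : ℝ} (hs : 0 ≤ s) (ht : 0 ≤ t) (x : X) :
    S.toFun (s + t).toNNReal x = S.toFun s.toNNReal (S.toFun t.toNNReal x) := by
  rw [Real.toNNReal_add hs ht, S.map_add']
  rfl

theorem toFun_zero_apply (x : X) : S.toFun 0 x = x := by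
  rw [S.map_zero']
  rfl

theorem exists_norm_toFun_le [CompleteSpace X] (T : ℝ≥0) :
    ∃ M : ℝ, 0 ≤ M ∧ ∀ t ≤ T, ‖S.toFun t‖ ≤ M := by
  obtain ⟨M, hM⟩ := banach_steinhaus (g := fun t : Set.Icc (0 : ℝ≥0) T => S.toFun t) (by
    intro x
    obtain ⟨C, hC⟩ := (isCompact_Icc (a := (0 : ℝ≥0)) (b := T)).exists_bound_of_continuousOn
      (S.continuous' x).continuousOn
    exact ⟨C, fun t => hC t t.2⟩)
  exact ⟨M, (norm_nonneg _).trans (hM ⟨0, by simp⟩), fun t ht => hM ⟨t, by simp, ht⟩⟩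

section Integral

variable [NormedSpace ℝ X] [IsScalarTower ℝ 𝕜 X]

theorem coe_smul_eq (r : ℝ) (x : X) : ((r : 𝕜)) • x = r • x := by
  rw [← algebraMap_smul 𝕜 r x, RCLike.algebraMap_eq_ofReal]

theorem HasGen.hasDerivWithinAt {S : C0Semigroup 𝕜 X} {x y : X} (h : S.HasGen x y) {t : ℝ}
    (ht : 0 ≤ t) :
    HasDerivWithinAt (fun s : ℝ => S.toFun s.toNNReal x) (S.toFun t.toNNReal y) (Set.Ioi t) t := by
  rw [hasDerivWithinAt_iff_tendsto_slope' (by simp)]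
  have h1 : Tendsto (fun s : ℝ => (s - t).toNNReal) (𝓝[>] t) (𝓝[>] 0) := by
    rw [tendsto_nhdsWithin_iff]
    constructor
    · have : Continuous fun s : ℝ => (s - t).toNNReal := by fun_prop
      exact (this.tendsto' t 0 (by simp)).mono_left nhdsWithin_le_nhds
    · filter_upwards [self_mem_nhdsWithin] with s hs
      simpa using hs
  refine (h.flow t.toNNReal |>.comp h1).congr' ?_
  filter_upwards [self_mem_nhdsWithin] with s hs
  have hs' : 0 < s - t := sub_pos.2 hs
  have e : S.toFun s.toNNReal x = S.toFun (s - t).toNNReal (S.toFun t.toNNReal x) := by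
    rw [← S.toFun_add_toNNReal hs'.le ht, sub_add_cancel]
  simp only [Function.comp, quot, slope_def_module, e, Real.coe_toNNReal _ hs'.le]
  rw [← RCLike.ofReal_inv, coe_smul_eq]

variable [CompleteSpace X]

/-- The orbit of a domain element has a continuous right derivative, so the fundamental theorem
applies; conversely, the integral has derivative `y` at `0`. Unlike the limit defining `HasGen`, the
integral form visibly passes to limits in `(x, y)`. -/
theorem hasGen_iff_integral (x y : X) :
    S.HasGen x y ↔
      ∀ t : ℝ, 0 ≤ t → S.toFun t.toNNReal x - x = ∫ s in (0 : ℝ)..t, S.toFun s.toNNReal y := by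
  constructor
  · intro h t ht
    rw [intervalIntegral.integral_eq_sub_of_hasDeriv_right
      (f := fun s : ℝ => S.toFun s.toNNReal x)
      (S.continuous_toFun_toNNReal x).continuousOn _
      ((S.continuous_toFun_toNNReal y).intervalIntegrable _ _)]
    · simp [S.toFun_zero_apply]
    · intro s hs
      rw [min_eq_left ht] at hs
      exact h.hasDerivWithinAt hs.1.le
  · intro h
    have hc := S.continuous_toFun_toNNReal y
    have hd : HasDerivAt (fun t : ℝ => ∫ s in (0 : ℝ)..t, S.toFun s.toNNReal y) y 0 := by
      have := intervalIntegral.integral_hasDerivAt_right (hc.intervalIntegrable 0 0)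
        hc.stronglyMeasurable.stronglyMeasurableAtFilter hc.continuousAt
      simpa [S.toFun_zero_apply] using this
    have hd' := (hasDerivWithinAt_iff_tendsto_slope' (s := Set.Ioi (0 : ℝ)) (by simp)).1
      hd.hasDerivWithinAt
    have h1 : Tendsto (fun s : ℝ≥0 => (s : ℝ)) (𝓝[>] 0) (𝓝[>] 0) := by
      rw [tendsto_nhdsWithin_iff]
      constructor
      · exact (NNReal.continuous_coe.tendsto' 0 0 (by simp)).mono_left nhdsWithin_le_nhds
      · filter_upwards [self_mem_nhdsWithin] with s hs
        simpa using hs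
    refine (hd'.comp h1).congr fun s => ?_
    simp only [Function.comp, slope_def_module, quot]
    rw [← h s s.2, ← RCLike.ofReal_inv, coe_smul_eq]
    simp

/-- Averaging an orbit puts any `x` into the domain. By the integral criterion this is a
rearrangement: both sides become differences of orbit integrals over subintervals of `[0, t + r]`.
-/
theorem hasGen_integral (x : X) {t : ℝ} (ht : 0 ≤ t) :
    S.HasGen (∫ s in (0 : ℝ)..t, S.toFun s.toNNReal x) (S.toFun t.toNNReal x - x) := by
  rw [hasGen_iff_integral]
  intro r hr
  have hc := S.continuous_toFun_toNNReal x
  have hi := fun a b : ℝ => hc.intervalIntegrable (μ := volume) a b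
  have e1 : S.toFun r.toNNReal (∫ s in (0 : ℝ)..t, S.toFun s.toNNReal x) =
      ∫ s in r..(t + r), S.toFun s.toNNReal x := by
    have h1 : (∫ s in (0 : ℝ)..t, S.toFun r.toNNReal (S.toFun s.toNNReal x)) =
        S.toFun r.toNNReal (∫ s in (0 : ℝ)..t, S.toFun s.toNNReal x) :=
      ((S.toFun r.toNNReal).restrictScalars ℝ).intervalIntegral_comp_comm (hi 0 t)
    have h2 := intervalIntegral.integral_comp_add_right (a := 0) (b := t)
      (fun s : ℝ => S.toFun s.toNNReal x) r
    rw [zero_add] at h2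
    rw [← h1, ← h2]
    refine intervalIntegral.integral_congr fun s hs => ?_
    rw [Set.uIcc_of_le ht] at hs
    rw [add_comm s r, S.toFun_add_toNNReal hr hs.1]
  have e2 : ∫ s in (0 : ℝ)..r, S.toFun s.toNNReal (S.toFun t.toNNReal x - x) =
      (∫ s in t..(t + r), S.toFun s.toNNReal x) - ∫ s in (0 : ℝ)..r, S.toFun s.toNNReal x := by
    have h2 := intervalIntegral.integral_comp_add_right (a := 0) (b := r)
      (fun s : ℝ => S.toFun s.toNNReal x) t
    rw [zero_add, add_comm r t] at h2
    have hi' : IntervalIntegrable (fun s : ℝ => S.toFun (s + t).toNNReal x) volume 0 r :=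
      (hc.comp (continuous_add_const t)).intervalIntegrable _ _
    rw [← h2, ← intervalIntegral.integral_sub hi' (hi _ _)]
    refine intervalIntegral.integral_congr fun s hs => ?_
    rw [Set.uIcc_of_le hr] at hs
    rw [S.toFun_add_toNNReal hs.1 ht, map_sub]
  rw [e1, e2, sub_eq_sub_iff_add_eq_add,
    add_comm (∫ s in r..(t + r), _),
    intervalIntegral.integral_add_adjacent_intervals (hi _ _) (hi _ _),
    add_comm (∫ s in t..(t + r), _),
    intervalIntegral.integral_add_adjacent_intervals (hi _ _) (hi _ _)]

end Integral

variable [CompleteSpace X]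

theorem isClosed_graph_A : IsClosed (S.A.graph : Set (X × X)) := by
  let _ : NormedSpace ℝ X := NormedSpace.restrictScalars ℝ 𝕜 X
  have : IsScalarTower ℝ 𝕜 X := IsScalarTower.restrictScalars ℝ 𝕜 X
  have e : (S.A.graph : Set (X × X)) = ⋂ (t : ℝ) (_ : 0 ≤ t),
      {p | S.toFun t.toNNReal p.1 - p.1 = ∫ s in (0 : ℝ)..t, S.toFun s.toNNReal (-p.2)} := by
    ext p
    simp only [SetLike.mem_coe, Set.mem_iInter, Set.mem_ofPred_eq]
    rw [← hasGen_iff_integral, ← mem_graph_A_iff]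
  rw [e]
  refine isClosed_iInter fun t => isClosed_iInter fun ht => isClosed_eq (by fun_prop) ?_
  obtain ⟨M, hM0, hM⟩ := S.exists_norm_toFun_le t.toNNReal
  have hi : ∀ y : X, IntervalIntegrable (fun s : ℝ => S.toFun s.toNNReal y) volume 0 t :=
    fun y => (S.continuous_toFun_toNNReal y).intervalIntegrable _ _
  have hL : LipschitzWith (M * t).toNNReal
      (fun y : X => ∫ s in (0 : ℝ)..t, S.toFun s.toNNReal y) := by
    refine LipschitzWith.of_dist_le_mul fun y z => ?_
    rw [dist_eq_norm, dist_eq_norm, ← intervalIntegral.integral_sub (hi y) (hi z),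
      Real.coe_toNNReal _ (mul_nonneg hM0 ht)]
    refine (intervalIntegral.norm_integral_le_of_norm_le_const (C := M * ‖y - z‖)
      fun s hs => ?_).trans_eq (by rw [sub_zero, abs_of_nonneg ht]; ring)
    rw [Set.uIoc_of_le ht] at hs
    rw [← map_sub]
    exact (S.toFun _).le_of_opNorm_le (hM _ (Real.toNNReal_le_toNNReal hs.2)) _
  exact hL.continuous.comp continuous_snd.neg

/-- `D(A*)` separates the points of `X`. -/
theorem eq_zero_of_forall_inner_DAdj {x : X} (h : ∀ ψ : S.DAdj, inner 𝕜 ψ.1.1 x = 0) : x = 0 := by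
  -- The adjoint test for the pair `(0, x)` involves only `⟨ψ, x⟩`, so the pair lies in the closed
  -- graph; `A` is single-valued.
  have h1 : ((0 : X), x) ∈ S.A.graph :=
    mem_of_forall_mem_adjoint S.isClosed_graph_A fun ψ hψ => by simpa using h ⟨ψ, hψ⟩
  exact LinearPMap.graph_fst_eq_zero_snd _ h1 rfl

/-- Since the integrated orbit lies in `D(A)` for every `x`, pairing it with `A* ψ` gives the weak
orbit equation without assuming `x ∈ D(A)`. -/
theorem inner_flow_sub (ψ : S.DAdj) (x : X) {t : ℝ} (ht : 0 ≤ t) :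
    inner 𝕜 ψ.1.1 (S.toFun t.toNNReal x - x) =
      -∫ s in (0 : ℝ)..t, inner 𝕜 ψ.1.2 (S.toFun s.toNNReal x) := by
  let _ : NormedSpace ℝ X := NormedSpace.restrictScalars ℝ 𝕜 X
  have : IsScalarTower ℝ 𝕜 X := IsScalarTower.restrictScalars ℝ 𝕜 X
  have h := (Submodule.mem_adjoint_iff _ _).1 ψ.2 (∫ s in (0 : ℝ)..t, S.toFun s.toNNReal x)
    (-(S.toFun t.toNNReal x - x)) (by
      rw [mem_graph_A_iff, neg_neg]
      exact S.hasGen_integral x ht)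
  have h1 : (∫ s in (0 : ℝ)..t, inner 𝕜 ψ.1.2 (S.toFun s.toNNReal x)) =
      inner 𝕜 ψ.1.2 (∫ s in (0 : ℝ)..t, S.toFun s.toNNReal x) :=
    ((innerSL 𝕜 ψ.1.2).restrictScalars ℝ).intervalIntegral_comp_comm
      ((S.continuous_toFun_toNNReal x).intervalIntegrable _ _)
  rw [h1, ← inner_conj_symm, ← inner_conj_symm ψ.1.2, ← map_neg]
  congr 1
  rw [inner_neg_left, sub_eq_zero] at h
  rw [← h, neg_neg]

end C0Semigroup
/-- A function whose increments over short intervals are at most `ε` times the increments of a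
fixed function, for every `ε`, is constant. -/
theorem eq_of_forall_norm_sub_le {E : Type*} [NormedAddCommGroup E] {a b : ℝ} (hab : a ≤ b)
    (H : ℝ → E) (m : ℝ → ℝ)
    (h : ∀ ε > 0, ∃ δ > 0, ∀ r s, a ≤ r → r ≤ s → s ≤ b → s - r < δ →
      ‖H s - H r‖ ≤ ε * (m s - m r)) : H b = H a := by
  have key : ∀ ε > 0, ‖H b - H a‖ ≤ ε * (m b - m a) := by
    intro ε hε
    obtain ⟨δ, hδ, hH⟩ := h ε hε
    obtain ⟨n, hn⟩ := exists_nat_gt ((b - a) / δ)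
    have hn0 : (0 : ℝ) < n := (div_nonneg (sub_nonneg.2 hab) hδ.le).trans_lt hn
    have hd0 : 0 ≤ (b - a) / n := div_nonneg (sub_nonneg.2 hab) hn0.le
    have hdδ : (b - a) / n < δ := by
      rw [div_lt_iff₀ hδ] at hn
      rw [div_lt_iff₀ hn0]
      linarith
    have hdn : (n : ℝ) * ((b - a) / n) = b - a := by field_simp
    have ind : ∀ i : ℕ, i ≤ n →
        ‖H (a + i * ((b - a) / n)) - H a‖ ≤ ε * (m (a + i * ((b - a) / n)) - m a) := by
      intro i
      induction i with
      | zero => simp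
      | succ i ih =>
        intro hi
        have h1 := ih (by omega)
        have hi' : ((i + 1 : ℕ) : ℝ) ≤ n := by exact_mod_cast hi
        have h2 := hH (a + i * ((b - a) / n)) (a + (i + 1 : ℕ) * ((b - a) / n))
          (le_add_of_nonneg_right (by positivity)) (by push_cast; linarith)
          (by have := mul_le_mul_of_nonneg_right hi' hd0; linarith)
          (by push_cast; linarith)
        refine (norm_sub_le_norm_sub_add_norm_sub _ (H (a + i * ((b - a) / n))) _).trans ?_
        linarith
    have := ind n le_rfl
    rwa [hdn, add_sub_cancel] at this
  have hlim : Tendsto (fun ε : ℝ => ε * (m b - m a)) (𝓝[>] 0) (𝓝 0) :=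
    ((continuous_mul_const (m b - m a)).tendsto' 0 0 (by simp)).mono_left nhdsWithin_le_nhds
  have h0 : ‖H b - H a‖ ≤ 0 :=
    ge_of_tendsto hlim (by filter_upwards [self_mem_nhdsWithin] with ε hε using key ε hε)
  exact sub_eq_zero.1 (norm_le_zero_iff.1 h0)

theorem exists_norm_apply_apply_le {𝕜 E F : Type*} [RCLike 𝕜]
    [NormedAddCommGroup E] [NormedSpace 𝕜 E] [NormedAddCommGroup F] [NormedSpace 𝕜 F]
    (B : E →L[𝕜] F →L⋆[𝕜] 𝕜) : ∃ K : ℝ, 0 ≤ K ∧ ∀ v w, ‖B v w‖ ≤ K * ‖v‖ * ‖w‖ :=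
  ⟨‖B‖, norm_nonneg B, fun v w => (B v).le_of_opNorm_le (B.le_opNorm v) w⟩

theorem continuous_apply_apply {𝕜 E F : Type*} [RCLike 𝕜]
    [NormedAddCommGroup E] [NormedSpace 𝕜 E] [NormedAddCommGroup F] [NormedSpace 𝕜 F]
    (B : E →L[𝕜] F →L⋆[𝕜] 𝕜) : Continuous fun p : E × F => B p.1 p.2 := by
  obtain ⟨K, hK0, hK⟩ := exists_norm_apply_apply_le B
  refine continuous_iff_continuousAt.2 fun q => tendsto_iff_norm_sub_tendsto_zero.2 ?_
  have hlim : Tendsto (fun p : E × F => K * ‖p.1 - q.1‖ * ‖p.2‖ + K * ‖q.1‖ * ‖p.2 - q.2‖)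
      (𝓝 q) (𝓝 0) := by
    refine Continuous.tendsto' ?_ _ _ (by simp)
    fun_prop
  refine squeeze_zero (fun _ => norm_nonneg _) (fun p => ?_) hlim
  have e : B p.1 p.2 - B q.1 q.2 = B (p.1 - q.1) p.2 + B q.1 (p.2 - q.2) := by simp
  rw [e]
  exact (norm_add_le _ _).trans (add_le_add (hK _ _) (hK _ _))

theorem intervalIntegrable_inner_ext {𝕜 X : Type*} [RCLike 𝕜] [NormedAddCommGroup X]
    [InnerProductSpace 𝕜 X] {T : ℝ} (x : C(Set.Icc (0 : ℝ) T, X)) {a b : ℝ}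
    (ha : a ∈ Set.Icc 0 T) (hb : b ∈ Set.Icc 0 T) {φ : ℝ → X} (hφ : Continuous φ) :
    IntervalIntegrable (fun s => inner 𝕜 (φ s) (ext x s)) volume a b :=
  ContinuousOn.intervalIntegrable
    (hφ.continuousOn.inner ((continuousOn_ext x).mono (Set.uIcc_subset_Icc ha hb)))

/-! ### Strong continuity of the adjoint semigroup and the weak variation of constants formula. -/

section VariationOfConstants

variable {𝕜 X : Type*} [RCLike 𝕜] [NormedAddCommGroup X] [InnerProductSpace 𝕜 X]
  [CompleteSpace X]

namespace C0Semigroup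

variable (S : C0Semigroup 𝕜 X)

theorem dense_fst_DAdj : Dense (Set.range fun ψ : S.DAdj => ψ.1.1) := by
  have h : (S.DAdj.map (LinearMap.fst 𝕜 X X)).topologicalClosure = ⊤ := by
    rw [Submodule.topologicalClosure_eq_top_iff, Submodule.eq_bot_iff]
    intro x hx
    rw [Submodule.mem_orthogonal] at hx
    exact S.eq_zero_of_forall_inner_DAdj fun ψ => hx _ ⟨ψ.1, ψ.2, rfl⟩
  have h' := Submodule.dense_iff_topologicalClosure_eq_top.2 h
  refine h'.mono ?_
  rintro _ ⟨ψ, hψ, rfl⟩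
  exact ⟨⟨ψ, hψ⟩, rfl⟩

theorem inner_flow_sub_flow (ψ : S.DAdj) (x : X) {s t : ℝ} (hs : 0 ≤ s) (ht : 0 ≤ t) :
    inner 𝕜 ψ.1.1 (S.toFun t.toNNReal x - S.toFun s.toNNReal x) =
      -∫ r in s..t, inner 𝕜 ψ.1.2 (S.toFun r.toNNReal x) := by
  have hi : ∀ a b : ℝ, IntervalIntegrable
      (fun r : ℝ => inner 𝕜 ψ.1.2 (S.toFun r.toNNReal x)) volume a b := fun a b =>
    (continuous_const.inner (S.continuous_toFun_toNNReal x)).intervalIntegrable a b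
  rw [← intervalIntegral.integral_interval_sub_left (hi 0 t) (hi 0 s), neg_sub',
    ← S.inner_flow_sub ψ x ht, ← S.inner_flow_sub ψ x hs, ← inner_sub_right,
    sub_sub_sub_cancel_right]

theorem norm_adjoint_flow_sub_le (ψ : S.DAdj) {M : ℝ} (hM0 : 0 ≤ M) {T : ℝ≥0}
    (hM : ∀ t ≤ T, ‖S.toFun t‖ ≤ M) {s t : ℝ≥0} (hs : s ≤ T) (ht : t ≤ T) :
    ‖(S.toFun t).adjoint ψ.1.1 - (S.toFun s).adjoint ψ.1.1‖ ≤ M * ‖ψ.1.2‖ * dist t s := by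
  refine (innerSL_apply_norm (𝕜 := 𝕜) _).symm.trans_le
    (ContinuousLinearMap.opNorm_le_bound _ (by positivity) fun x => ?_)
  rw [innerSL_apply_apply, inner_sub_left, ContinuousLinearMap.adjoint_inner_left,
    ContinuousLinearMap.adjoint_inner_left, ← inner_sub_right]
  have h := S.inner_flow_sub_flow ψ x s.2 t.2
  simp only [NNReal.val_eq_coe, Real.toNNReal_coe] at h
  rw [h, norm_neg]
  refine (intervalIntegral.norm_integral_le_of_norm_le_const (C := ‖ψ.1.2‖ * (M * ‖x‖))
    fun r hr => ?_).trans_eq ?_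
  · refine (norm_inner_le_norm _ _).trans ?_
    gcongr
    refine (S.toFun _).le_of_opNorm_le (hM _ (Real.toNNReal_le_iff_le_coe.2 ?_)) _
    exact hr.2.trans (max_le hs ht)
  · rw [NNReal.dist_eq]
    ring

/-- On bounded time intervals the adjoint orbits of elements of `D(A*)` are Lipschitz, and the
operators are uniformly bounded. Density of `D(A*)` makes every adjoint orbit a locally uniform
limit of such orbits. -/
theorem continuous_adjoint_flow (y : X) : Continuous fun t : ℝ≥0 => (S.toFun t).adjoint y := by
  have hon : ∀ T : ℝ≥0, ContinuousOn (fun t : ℝ≥0 => (S.toFun t).adjoint y) (Set.Iic T) := by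
    intro T
    obtain ⟨M, hM0, hM⟩ := S.exists_norm_toFun_le T
    refine continuousOn_of_uniform_approx_of_continuousOn fun V hV => ?_
    obtain ⟨ε, hε, hV⟩ := Metric.mem_uniformity_dist.1 hV
    obtain ⟨_, ⟨ψ, rfl⟩, hψ⟩ := S.dense_fst_DAdj.exists_dist_lt y
      (ε := ε / (M + 1)) (by positivity)
    refine ⟨fun t => (S.toFun t).adjoint ψ.1.1, ?_, fun t ht => hV ?_⟩
    · refine LipschitzOnWith.continuousOn (K := (M * ‖ψ.1.2‖).toNNReal)
        (LipschitzOnWith.of_dist_le_mul fun t ht s hs => ?_)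
      rw [Real.coe_toNNReal _ (by positivity), dist_eq_norm]
      exact S.norm_adjoint_flow_sub_le ψ hM0 hM hs ht
    · rw [dist_eq_norm, ← map_sub]
      rw [dist_eq_norm] at hψ
      have h1 : ‖(S.toFun t).adjoint‖ ≤ M := by
        rw [LinearIsometryEquiv.norm_map]
        exact hM t ht
      calc _ ≤ M * ‖y - ψ.1.1‖ := ContinuousLinearMap.le_of_opNorm_le _ h1 _
        _ ≤ (M + 1) * ‖y - ψ.1.1‖ := by gcongr; linarith
        _ < (M + 1) * (ε / (M + 1)) := by gcongr
        _ = ε := by field_simp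
  refine continuous_iff_continuousAt.2 fun t => (hon (t + 1)).continuousAt (Iic_mem_nhds ?_)
  exact lt_add_of_pos_right t one_pos

theorem continuous_adjFlow (ψ : S.DAdj) : Continuous fun t : ℝ≥0 => S.adjFlow t ψ :=
  ((S.continuous_adjoint_flow _).prodMk (S.continuous_adjoint_flow _)).subtype_mk _

theorem adjFlow_zero (ψ : S.DAdj) : S.adjFlow 0 ψ = ψ := by
  ext <;> simp [adjFlow, S.map_zero', ContinuousLinearMap.adjoint_id]

theorem norm_adjFlow_fst_le (ψ : S.DAdj) {t : ℝ≥0} {M : ℝ} (hM : ‖S.toFun t‖ ≤ M) :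
    ‖(S.adjFlow t ψ).1.1‖ ≤ M * ‖ψ.1.1‖ :=
  ContinuousLinearMap.le_of_opNorm_le _ ((LinearIsometryEquiv.norm_map _ _).trans_le hM) _

end C0Semigroup

variable {U : Type*} [NormedAddCommGroup U] [InnerProductSpace 𝕜 U] {S : C0Semigroup 𝕜 X}

theorem intervalIntegrable_control (B : U →L[𝕜] S.Xminus) {u : ℝ → U} {a b : ℝ}
    (hu : IntervalIntegrable u volume a b) {φ : ℝ → S.DAdj} (hφ : Continuous φ) :
    IntervalIntegrable (fun s => B (u s) (φ s)) volume a b := by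
  obtain ⟨P, hP⟩ := (isCompact_uIcc (a := a) (b := b)).exists_bound_of_continuousOn hφ.continuousOn
  obtain ⟨K, hK0, hK⟩ := exists_norm_apply_apply_le B
  have hB : Continuous fun p : U × S.DAdj => B p.1 p.2 := continuous_apply_apply B
  refine (hu.norm.const_mul (K * P)).mono_fun'
    (hB.comp_aestronglyMeasurable
      (hu.def'.aestronglyMeasurable.prodMk hφ.aestronglyMeasurable)) ?_
  refine (ae_restrict_mem measurableSet_uIoc).mono fun s hs => ?_
  refine (hK _ _).trans ?_
  calc K * ‖u s‖ * ‖φ s‖ ≤ K * ‖u s‖ * P := by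
        gcongr
        exact hP s (Set.uIoc_subset_uIcc hs)
    _ = K * P * ‖u s‖ := by ring

theorem intervalIntegrable_L2 {T : ℝ} (hT : 0 ≤ T) (u : L2 0 T U) {a b : ℝ}
    (ha : a ∈ Set.Icc 0 T) (hb : b ∈ Set.Icc 0 T) : IntervalIntegrable u volume a b := by
  have h : IntervalIntegrable u volume 0 T :=
    (intervalIntegrable_iff_integrableOn_Ioc_of_le hT).2 ((Lp.memLp u).integrable one_le_two)
  refine h.mono_set ?_
  rw [Set.uIcc_of_le hT]
  exact Set.uIcc_subset_Icc ha hb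

namespace IsSolution

variable {B : U →L[𝕜] S.Xminus} {T : ℝ} {x₀ : X} {u : L2 0 T U} {x : C(Set.Icc (0 : ℝ) T, X)}

theorem inner_sub (hx : IsSolution S B x₀ u x) {r q : ℝ} (hr : r ∈ Set.Icc 0 T)
    (hq : q ∈ Set.Icc 0 T) (ψ : S.DAdj) :
    inner 𝕜 ψ.1.1 (ext x q - ext x r) =
      (∫ s in r..q, B (u s) ψ) - ∫ s in r..q, inner 𝕜 ψ.1.2 (ext x s) := by
  have hT : 0 ≤ T := hr.1.trans hr.2
  have h0 : (0 : ℝ) ∈ Set.Icc 0 T := ⟨le_rfl, hT⟩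
  have h1 := hx ⟨q, hq⟩ ψ
  have h2 := hx ⟨r, hr⟩ ψ
  rw [← ext_coe x] at h1 h2
  have e1 := intervalIntegral.integral_interval_sub_left
    (intervalIntegrable_control B (intervalIntegrable_L2 hT u h0 hq) (continuous_const (y := ψ)))
    (intervalIntegrable_control B (intervalIntegrable_L2 hT u h0 hr) continuous_const)
  have e2 := intervalIntegral.integral_interval_sub_left
    (intervalIntegrable_inner_ext (𝕜 := 𝕜) x h0 hq (continuous_const (y := ψ.1.2)))
    (intervalIntegrable_inner_ext x h0 hr continuous_const)
  rw [← e1, ← e2, inner_sub_right]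
  linear_combination h1 - h2

/-- Formally `s ↦ ⟨S(b - s)* ψ, x(s)⟩` has derivative `B (u s) (S(b - s)* ψ)`, the terms with `A*`
cancelling. The proof avoids pointwise derivatives, `u` being only square integrable, and bounds
increments instead. -/
theorem inner_eq_flow_add_integral (hx : IsSolution S B x₀ u x) {a b : ℝ}
    (ha : a ∈ Set.Icc 0 T) (hb : b ∈ Set.Icc 0 T) (hab : a ≤ b) (ψ : S.DAdj) :
    inner 𝕜 ψ.1.1 (ext x b) = inner 𝕜 (S.adjFlow (b - a).toNNReal ψ).1.1 (ext x a) +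
      ∫ s in a..b, B (u s) (S.adjFlow (b - s).toNNReal ψ) := by
  have hT : 0 ≤ T := ha.1.trans ha.2
  set φ : ℝ → S.DAdj := fun s => S.adjFlow (b - s).toNNReal ψ with hφdef
  have hφ : Continuous φ := (S.continuous_adjFlow ψ).comp (by fun_prop)
  have hφ2 : Continuous fun s => (φ s).1.2 :=
    continuous_snd.comp (continuous_subtype_val.comp hφ)
  have hsub : Set.Icc a b ⊆ Set.Icc 0 T := Set.Icc_subset_Icc ha.1 hb.2
  obtain ⟨P, hP⟩ := (isCompact_Icc (a := a) (b := b)).exists_bound_of_continuousOn hφ.continuousOn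
  have hui : ∀ {r q}, r ∈ Set.Icc a b → q ∈ Set.Icc a b → IntervalIntegrable u volume r q :=
    fun hr hq => intervalIntegrable_L2 hT u (hsub hr) (hsub hq)
  have haa : a ∈ Set.Icc a b := ⟨le_rfl, hab⟩
  obtain ⟨K, hK0, hK⟩ := exists_norm_apply_apply_le B
  set g : ℝ → ℝ := fun s => ‖x‖ + P + K * ‖u s‖ with hg
  have hgi : ∀ {r q}, r ∈ Set.Icc a b → q ∈ Set.Icc a b → IntervalIntegrable g volume r q :=
    fun hr hq => intervalIntegrable_const.add ((hui hr hq).norm.const_mul _)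
  -- The weak equation on `[r, q]` is tested with the frozen `φ q`, and the flow of `φ` with the
  -- frozen state `ext x r`. What remains are differences that are uniformly small on short
  -- intervals, with weight at most `g`.
  have key : ∀ r q, a ≤ r → r ≤ q → q ≤ b →
      (inner 𝕜 (φ q).1.1 (ext x q) - ∫ s in a..q, B (u s) (φ s)) -
        (inner 𝕜 (φ r).1.1 (ext x r) - ∫ s in a..r, B (u s) (φ s)) =
      ∫ s in r..q, ((inner 𝕜 (φ s).1.2 (ext x r) - inner 𝕜 (φ q).1.2 (ext x s)) +
        B (u s) (φ q - φ s)) := by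
    intro r q har hrq hqb
    have hr : r ∈ Set.Icc a b := ⟨har, hrq.trans hqb⟩
    have hq : q ∈ Set.Icc a b := ⟨har.trans hrq, hqb⟩
    have e1 := hx.inner_sub (hsub hr) (hsub hq) (φ q)
    have e2 : inner 𝕜 (φ q).1.1 (ext x r) - inner 𝕜 (φ r).1.1 (ext x r) =
        ∫ s in r..q, inner 𝕜 (φ s).1.2 (ext x r) := by
      have h1 := S.inner_flow_sub_flow ψ (ext x r) (s := b - r) (t := b - q)
        (sub_nonneg.2 hr.2) (sub_nonneg.2 hqb)
      rw [← intervalIntegral.integral_symm, ← intervalIntegral.integral_comp_sub_left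
        (fun s => inner 𝕜 ψ.1.2 (S.toFun s.toNNReal (ext x r))), inner_sub_right] at h1
      simpa [hφdef, C0Semigroup.adjFlow, ContinuousLinearMap.adjoint_inner_left] using h1
    have e3 := intervalIntegral.integral_interval_sub_left
      (intervalIntegrable_control B (hui haa hq) hφ) (intervalIntegrable_control B (hui haa hr) hφ)
    have i1 := hφ2.inner (𝕜 := 𝕜) (continuous_const (y := ext x r)) |>.intervalIntegrable
      (μ := volume) r q
    have i2 := intervalIntegrable_inner_ext (𝕜 := 𝕜) x (hsub hr) (hsub hq)
      (continuous_const (y := (φ q).1.2))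
    have i3 := intervalIntegrable_control B (hui hr hq) (continuous_const (y := φ q))
    have i4 := intervalIntegrable_control B (hui hr hq) hφ
    simp only [map_sub]
    rw [intervalIntegral.integral_add (i1.sub i2) (i3.sub i4),
      intervalIntegral.integral_sub i1 i2, intervalIntegral.integral_sub i3 i4, ← e3]
    rw [inner_sub_right] at e1
    linear_combination e1 + e2
  have hconst := eq_of_forall_norm_sub_le hab
    (fun r => inner 𝕜 (φ r).1.1 (ext x r) - ∫ s in a..r, B (u s) (φ s))
    (fun r => ∫ s in a..r, g s) (by
      intro ε hε
      obtain ⟨δ₁, hδ₁, h₁⟩ := Metric.uniformContinuousOn_iff.1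
        (isCompact_Icc.uniformContinuousOn_of_continuous (hφ.continuousOn (s := Set.Icc a b))) ε hε
      obtain ⟨δ₂, hδ₂, h₂⟩ := Metric.uniformContinuousOn_iff.1
        (isCompact_Icc.uniformContinuousOn_of_continuous ((continuousOn_ext x).mono hsub)) ε hε
      refine ⟨min δ₁ δ₂, lt_min hδ₁ hδ₂, fun r q har hrq hqb hd => ?_⟩
      have hr : r ∈ Set.Icc a b := ⟨har, hrq.trans hqb⟩
      have hq : q ∈ Set.Icc a b := ⟨har.trans hrq, hqb⟩
      rw [key r q har hrq hqb, intervalIntegral.integral_interval_sub_left (hgi haa hq)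
        (hgi haa hr), ← intervalIntegral.integral_const_mul]
      refine intervalIntegral.norm_integral_le_of_norm_le hrq
        (Eventually.of_forall fun s hs => ?_) ((hgi hr hq).const_mul ε)
      have hs' : s ∈ Set.Icc a b := ⟨har.trans hs.1.le, hs.2.trans hqb⟩
      have d1 : ‖φ q - φ s‖ ≤ ε := by
        rw [← dist_eq_norm]
        refine (h₁ q hq s hs' ?_).le
        rw [Real.dist_eq, abs_of_nonneg (sub_nonneg.2 hs.2)]
        linarith [min_le_left δ₁ δ₂, hs.1]
      have d2 : ‖ext x r - ext x s‖ ≤ ε := by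
        rw [← dist_eq_norm]
        refine (h₂ r hr s hs' ?_).le
        rw [Real.dist_eq, abs_sub_comm, abs_of_nonneg (sub_nonneg.2 hs.1.le)]
        linarith [min_le_right δ₁ δ₂, hs.2]
      have d3 : ‖(φ s).1.2 - (φ q).1.2‖ ≤ ε := by
        rw [norm_sub_rev]
        exact (norm_snd_le (φ q - φ s).1).trans d1
      have d4 : ‖(φ q).1.2‖ ≤ P := (norm_snd_le (φ q).1).trans (hP q hq)
      have e : inner 𝕜 (φ s).1.2 (ext x r) - inner 𝕜 (φ q).1.2 (ext x s) =
          inner 𝕜 ((φ s).1.2 - (φ q).1.2) (ext x r) +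
            inner 𝕜 (φ q).1.2 (ext x r - ext x s) := by
        rw [inner_sub_left, inner_sub_right]
        ring
      rw [e]
      have hP0 : 0 ≤ P := (norm_nonneg _).trans d4
      calc _ ≤ ‖(φ s).1.2 - (φ q).1.2‖ * ‖ext x r‖ + ‖(φ q).1.2‖ * ‖ext x r - ext x s‖ +
            K * ‖u s‖ * ‖φ q - φ s‖ :=
            norm_add₃_le.trans (add_le_add (add_le_add (norm_inner_le_norm _ _)
              (norm_inner_le_norm _ _)) (hK _ _))
        _ ≤ ε * ‖x‖ + P * ε + K * ‖u s‖ * ε := by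
            gcongr
            exact norm_ext_le x r
        _ = ε * g s := by
            simp only [hg]
            ring)
  have hbb : φ b = ψ := by simp [hφdef, S.adjFlow_zero]
  simp only [hbb, intervalIntegral.integral_same, sub_zero] at hconst
  exact sub_eq_iff_eq_add.1 hconst

end IsSolution

end VariationOfConstants

/-! ### Tools in `L²`: Hölder, projection onto closed affine sets, time shifts. -/

section Prelim

theorem exists_integral_norm_le {U : Type*} [NormedAddCommGroup U] (T : ℝ) :
    ∃ C : ℝ, 0 ≤ C ∧ ∀ u : L2 0 T U, ∫ s in Set.Ioc 0 T, ‖u s‖ ≤ C * ‖u‖ := by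
  refine ⟨((volume.restrict (Set.Ioc 0 T) Set.univ) ^ (1 / (1 : ENNReal).toReal -
    1 / (2 : ENNReal).toReal)).toReal, ENNReal.toReal_nonneg, fun u => ?_⟩
  rw [integral_norm_eq_lintegral_enorm (Lp.aestronglyMeasurable u),
    ← eLpNorm_one_eq_lintegral_enorm, Lp.norm_def, mul_comm, ← ENNReal.toReal_mul]
  refine ENNReal.toReal_mono (ENNReal.mul_ne_top (Lp.eLpNorm_ne_top u) ?_)
    (eLpNorm_le_eLpNorm_mul_rpow_measure_univ one_le_two (Lp.aestronglyMeasurable u))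
  exact ENNReal.rpow_ne_top_of_nonneg (by norm_num) (measure_ne_top _ _)

/-- A nonempty closed affine subset of a Hilbert space has a point nearest to a given one. -/
theorem exists_forall_norm_sub_le {𝕜 E : Type*} [RCLike 𝕜] [NormedAddCommGroup E]
    [InnerProductSpace 𝕜 E] [CompleteSpace E] {K : Set E} (hne : K.Nonempty) (hc : IsClosed K)
    (hK : ∀ u ∈ K, ∀ v ∈ K, ∀ c : 𝕜, u + c • (v - u) ∈ K) (w : E) :
    ∃ v ∈ K, ∀ u ∈ K, ‖v - w‖ ≤ ‖u - w‖ := by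
  let _ : InnerProductSpace ℝ E := InnerProductSpace.rclikeToReal 𝕜 E
  have hconv : Convex ℝ K := by
    intro u hu v hv a b ha hb hab
    have h := hK u hu v hv (b : 𝕜)
    have e : a • u + b • v = u + b • (v - u) := by
      rw [eq_sub_of_add_eq hab, sub_smul, one_smul, smul_sub]
      abel
    rw [e]
    exact h
  obtain ⟨v, hv, hmin⟩ := exists_norm_eq_iInf_of_complete_convex hne hc.isComplete hconv w
  refine ⟨v, hv, fun u hu => ?_⟩
  rw [norm_sub_rev v, norm_sub_rev u, hmin]
  exact ciInf_le ⟨0, Set.forall_mem_range.2 fun _ => norm_nonneg _⟩ (⟨u, hu⟩ : K)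

theorem ext_add_smul {𝕜 X : Type*} [RCLike 𝕜] [NormedAddCommGroup X] [NormedSpace 𝕜 X] {T : ℝ}
    (x y : C(Set.Icc (0 : ℝ) T, X)) (c : 𝕜) : ext (x + c • y) = ext x + c • ext y := by
  funext s
  simp only [Pi.add_apply, Pi.smul_apply, ext]
  split_ifs <;> simp

theorem stateL2_add_smul {𝕜 X : Type*} [RCLike 𝕜] [NormedAddCommGroup X] [NormedSpace 𝕜 X]
    {T : ℝ} (x y : C(Set.Icc (0 : ℝ) T, X)) (c : 𝕜) :
    stateL2 (x + c • y) = stateL2 x + c • stateL2 y := by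
  unfold stateL2
  rw [← MemLp.toLp_const_smul, ← MemLp.toLp_add]
  exact MemLp.toLp_congr _ _ (by rw [ext_add_smul x y c])

/-- A control on `(0, T)`, extended by zero and seen through the window `(t - τ, t)`. -/
theorem exists_shift {U : Type*} [NormedAddCommGroup U] {T : ℝ} (u : L2 0 T U) (τ d : ℝ) :
    ∃ v : L2 0 τ U, ‖v‖ ≤ ‖u‖ ∧ ∀ᵐ s ∂(volume.restrict (Set.Ioc 0 τ)),
      v s = (Set.Ioc 0 T).indicator u (s + d) := by
  have hm : MeasurePreserving (fun s : ℝ => s + d) volume volume :=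
    measurePreserving_add_right volume d
  have h1 : MemLp ((Set.Ioc 0 T).indicator u) 2 volume :=
    (memLp_indicator_iff_restrict measurableSet_Ioc).2 (Lp.memLp u)
  have h2 : MemLp (fun s => (Set.Ioc 0 T).indicator u (s + d)) 2 volume :=
    h1.comp_measurePreserving hm
  have h3 : eLpNorm (fun s => (Set.Ioc 0 T).indicator u (s + d)) 2
      (volume.restrict (Set.Ioc 0 τ)) ≤ eLpNorm u 2 (volume.restrict (Set.Ioc 0 T)) := by
    rw [← eLpNorm_indicator_eq_eLpNorm_restrict (f := u) (s := Set.Ioc 0 T) measurableSet_Ioc,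
      ← eLpNorm_comp_measurePreserving h1.1 hm]
    exact eLpNorm_mono_measure _ Measure.restrict_le_self
  refine ⟨(h2.restrict (Set.Ioc 0 τ)).toLp _, ?_, MemLp.coeFn_toLp _⟩
  rw [Lp.norm_toLp, Lp.norm_def]
  exact ENNReal.toReal_mono (Lp.eLpNorm_ne_top u) h3

end Prelim

/-! ### Linearity and closedness of the solution relation; the admissibility estimate. -/

section ControlMaps

variable {𝕜 X U : Type*} [RCLike 𝕜]
  [NormedAddCommGroup X] [InnerProductSpace 𝕜 X] [CompleteSpace X]
  [NormedAddCommGroup U] [InnerProductSpace 𝕜 U]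
  {S : C0Semigroup 𝕜 X} {B : U →L[𝕜] S.Xminus}

/-- Integration of the control against a continuous curve in `D(A*)`, as a functional. -/
theorem exists_controlFunctional (B : U →L[𝕜] S.Xminus) {T t : ℝ} (ht : t ∈ Set.Icc 0 T)
    {φ : ℝ → S.DAdj} (hφ : Continuous φ) :
    ∃ l : L2 0 T U →L[𝕜] 𝕜, ∀ u : L2 0 T U, l u = ∫ s in (0 : ℝ)..t, B (u s) (φ s) := by
  have hT : 0 ≤ T := ht.1.trans ht.2
  have hi : ∀ u : L2 0 T U, IntervalIntegrable (fun s => B (u s) (φ s)) volume 0 t := fun u =>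
    intervalIntegrable_control B (intervalIntegrable_L2 hT u ⟨le_rfl, hT⟩ ht) hφ
  have hsub : Set.uIoc 0 t ⊆ Set.Ioc 0 T := by
    rw [Set.uIoc_of_le ht.1]
    exact Set.Ioc_subset_Ioc_right ht.2
  obtain ⟨K, hK0, hK⟩ := exists_norm_apply_apply_le B
  obtain ⟨C, hC0, hC⟩ := exists_integral_norm_le (U := U) T
  obtain ⟨P, hP⟩ := (isCompact_Icc (a := 0) (b := T)).exists_bound_of_continuousOn hφ.continuousOn
  have hP0 : 0 ≤ P := (norm_nonneg _).trans (hP 0 ⟨le_rfl, hT⟩)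
  refine ⟨LinearMap.mkContinuous
    { toFun := fun u => ∫ s in (0 : ℝ)..t, B (u s) (φ s)
      map_add' := fun u v => ?_
      map_smul' := fun c u => ?_ } (K * P * C) fun u => ?_, fun u => rfl⟩
  · rw [← intervalIntegral.integral_add (hi u) (hi v)]
    refine intervalIntegral.integral_congr_ae ?_
    have h := (ae_restrict_iff' measurableSet_Ioc).1 (Lp.coeFn_add u v)
    filter_upwards [h] with s hs hst
    rw [hs (hsub hst)]
    simp
  · rw [RingHom.id_apply, smul_eq_mul, ← intervalIntegral.integral_const_mul]
    refine intervalIntegral.integral_congr_ae ?_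
    have h := (ae_restrict_iff' measurableSet_Ioc).1 (Lp.coeFn_smul c u)
    filter_upwards [h] with s hs hst
    rw [hs (hsub hst)]
    simp
  · have hn : IntegrableOn (fun s => K * P * ‖u s‖) (Set.Ioc 0 T) :=
      ((Lp.memLp u).integrable one_le_two).norm.const_mul _
    change ‖∫ s in (0 : ℝ)..t, B (u s) (φ s)‖ ≤ _
    calc ‖∫ s in (0 : ℝ)..t, B (u s) (φ s)‖ ≤ ∫ s in (0 : ℝ)..t, K * P * ‖u s‖ := by
          refine intervalIntegral.norm_integral_le_of_norm_le ht.1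
            (Eventually.of_forall fun s hs => ?_)
            ((intervalIntegrable_iff_integrableOn_Ioc_of_le ht.1).2
              (hn.mono_set (Set.Ioc_subset_Ioc_right ht.2)))
          have hs' : s ∈ Set.Icc 0 T := ⟨hs.1.le, hs.2.trans ht.2⟩
          calc _ ≤ K * ‖u s‖ * ‖φ s‖ := hK _ _
            _ ≤ K * ‖u s‖ * P := by
              gcongr
              exact hP s hs'
            _ = K * P * ‖u s‖ := by ring
      _ ≤ ∫ s in Set.Ioc 0 T, K * P * ‖u s‖ := by
          rw [intervalIntegral.integral_of_le ht.1]
          exact setIntegral_mono_set hn (Eventually.of_forall fun s => by positivity)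
            (Set.Ioc_subset_Ioc_right ht.2).eventuallyLE
      _ ≤ K * P * C * ‖u‖ := by
          rw [integral_const_mul, mul_assoc _ C]
          gcongr
          exact hC u

/-- The weak equation, tested at a given time with a given `ψ`, is a continuous linear equation
for the pair of control and state. -/
theorem exists_residual (B : U →L[𝕜] S.Xminus) {T : ℝ} (t : Set.Icc (0 : ℝ) T) (ψ : S.DAdj) :
    ∃ R : L2 0 T U × C(Set.Icc (0 : ℝ) T, X) →L[𝕜] 𝕜, ∀ p, R p =
      inner 𝕜 ψ.1.1 (p.2 t) + (∫ s in (0 : ℝ)..t, inner 𝕜 ψ.1.2 (ext p.2 s)) -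
        ∫ s in (0 : ℝ)..t, B (p.1 s) ψ := by
  have h0 : (0 : ℝ) ∈ Set.Icc 0 T := ⟨le_rfl, t.2.1.trans t.2.2⟩
  obtain ⟨l, hl⟩ := exists_controlFunctional B t.2 (continuous_const (y := ψ))
  have hi : ∀ x : C(Set.Icc (0 : ℝ) T, X),
      IntervalIntegrable (fun s => inner 𝕜 ψ.1.2 (ext x s)) volume 0 t := fun x =>
    intervalIntegrable_inner_ext x h0 t.2 continuous_const
  let m : C(Set.Icc (0 : ℝ) T, X) →L[𝕜] 𝕜 := LinearMap.mkContinuous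
    { toFun := fun x => ∫ s in (0 : ℝ)..t, inner 𝕜 ψ.1.2 (ext x s)
      map_add' := fun x y => by
        rw [← intervalIntegral.integral_add (hi x) (hi y)]
        have e := ext_add_smul x y (1 : 𝕜)
        rw [one_smul, one_smul] at e
        simp only [e, Pi.add_apply, inner_add_right]
      map_smul' := fun c x => by
        rw [RingHom.id_apply, smul_eq_mul, ← intervalIntegral.integral_const_mul]
        have e := ext_add_smul 0 x c
        have e0 : ext (0 : C(Set.Icc (0 : ℝ) T, X)) = 0 := by
          funext s
          simp [ext]
        rw [zero_add, e0, zero_add] at e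
        simp only [e, Pi.smul_apply, inner_smul_right] } (‖ψ.1.2‖ * |(t : ℝ) - 0|) fun x => by
      refine (intervalIntegral.norm_integral_le_of_norm_le_const (C := ‖ψ.1.2‖ * ‖x‖)
        fun s _ => ?_).trans_eq (by ring)
      refine (norm_inner_le_norm _ _).trans ?_
      gcongr
      exact norm_ext_le x s
  let ev : C(Set.Icc (0 : ℝ) T, X) →L[𝕜] 𝕜 :=
    (innerSL 𝕜 ψ.1.1).comp (ContinuousMap.evalCLM 𝕜 t)
  refine ⟨(ev + m).comp (ContinuousLinearMap.snd 𝕜 _ _) -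
    l.comp (ContinuousLinearMap.fst 𝕜 _ _), fun p => ?_⟩
  rw [← hl]
  rfl

namespace IsSolution

variable {T : ℝ} {x₀ : X} {u v : L2 0 T U} {x y : C(Set.Icc (0 : ℝ) T, X)}

theorem add_smul (hx : IsSolution S B x₀ u x) (hy : IsSolution S B 0 v y) (c : 𝕜) :
    IsSolution S B x₀ (u + c • v) (x + c • y) := by
  intro t ψ
  obtain ⟨R, hR⟩ := exists_residual B t ψ
  have h1 : R (u, x) = inner 𝕜 ψ.1.1 x₀ := by rw [hR, hx t ψ, add_sub_cancel_right]
  have h2 : R (v, y) = 0 := by rw [hR, hy t ψ, inner_zero_right, zero_add, sub_self]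
  have h3 : R (u + c • v, x + c • y) = R (u, x) + c • R (v, y) := by
    rw [← map_smul, ← map_add]
    rfl
  rw [h1, h2, smul_zero, add_zero, hR, sub_eq_iff_eq_add] at h3
  exact h3

theorem sub (hx : IsSolution S B x₀ u x) (hy : IsSolution S B x₀ v y) :
    IsSolution S B 0 (u - v) (x - y) := by
  intro t ψ
  obtain ⟨R, hR⟩ := exists_residual B t ψ
  have h1 : R (u, x) = inner 𝕜 ψ.1.1 x₀ := by rw [hR, hx t ψ, add_sub_cancel_right]
  have h2 : R (v, y) = inner 𝕜 ψ.1.1 x₀ := by rw [hR, hy t ψ, add_sub_cancel_right]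
  have h3 : R (u - v, x - y) = R (u, x) - R (v, y) := by
    rw [← map_sub]
    rfl
  rw [h1, h2, sub_self, hR, sub_eq_iff_eq_add, zero_add] at h3
  rw [inner_zero_right, zero_add]
  exact h3

theorem of_tendsto {w : ℕ → L2 0 T U} {z : ℕ → C(Set.Icc (0 : ℝ) T, X)}
    (h : ∀ n, IsSolution S B x₀ (w n) (z n)) (hw : Tendsto w atTop (𝓝 u))
    (hz : Tendsto z atTop (𝓝 x)) : IsSolution S B x₀ u x := by
  intro t ψ
  obtain ⟨R, hR⟩ := exists_residual B t ψ
  have h1 : ∀ n, R (w n, z n) = inner 𝕜 ψ.1.1 x₀ := fun n => by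
    rw [hR, h n t ψ, add_sub_cancel_right]
  have h2 : Tendsto (fun n => R (w n, z n)) atTop (𝓝 (R (u, x))) :=
    (R.continuous.tendsto _).comp (hw.prodMk_nhds hz)
  simp only [h1] at h2
  have h3 := tendsto_nhds_unique h2 tendsto_const_nhds
  rw [hR, sub_eq_iff_eq_add] at h3
  exact h3

end IsSolution

/-- The admissibility estimate: `‖∫₀^τ S(τ - s) B v(s) ds‖ ≤ C ‖v‖`, in weak form. -/
theorem Admissible.exists_norm_integral_le [CompleteSpace U] (hB : Admissible S B) :
    ∃ τ : ℝ, 0 < τ ∧ ∃ C : ℝ, 0 ≤ C ∧ ∀ (v : L2 0 τ U) (ψ : S.DAdj),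
      ‖∫ s in (0 : ℝ)..τ, B (v s) (S.adjFlow (τ - s).toNNReal ψ)‖ ≤ C * ‖v‖ * ‖ψ.1.1‖ := by
  obtain ⟨τ, hτ, h⟩ := hB
  refine ⟨τ, hτ, ?_⟩
  choose l hl using fun ψ : S.DAdj => exists_controlFunctional B (T := τ) ⟨hτ.le, le_rfl⟩
    ((S.continuous_adjFlow ψ).comp (by fun_prop : Continuous fun s : ℝ => (τ - s).toNNReal))
  have hlx : ∀ v, ∃ x : X, ∀ ψ : S.DAdj, l ψ v = inner 𝕜 ψ.1.1 x := fun v =>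
    (h v).imp fun x hx ψ => by rw [hl, hx ψ]; rfl
  -- Dividing by the norm of `ψ` in `X`, not its graph norm, gives a family bounded at each `v` by
  -- `‖x‖`, where `x ∈ X` is the value of the input map. The factor is `0` when `ψ.1.1 = 0`.
  obtain ⟨C, hC⟩ := banach_steinhaus
    (g := fun ψ : S.DAdj => ((‖ψ.1.1‖⁻¹ : ℝ) : 𝕜) • l ψ) (by
      intro v
      obtain ⟨x, hx⟩ := hlx v
      refine ⟨‖x‖, fun ψ => ?_⟩
      rw [smul_apply, hx, norm_smul, RCLike.norm_ofReal,
        abs_of_nonneg (by positivity)]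
      rcases eq_or_ne ‖ψ.1.1‖ 0 with h0 | h0
      · simp [h0]
      · rw [inv_mul_le_iff₀ (by positivity)]
        exact norm_inner_le_norm _ _)
  refine ⟨C, (norm_nonneg _).trans (hC 0), fun v ψ => ?_⟩
  have e : ∫ s in (0 : ℝ)..τ, B (v s) (S.adjFlow (τ - s).toNNReal ψ) = l ψ v := (hl ψ v).symm
  rw [e]
  rcases eq_or_ne ‖ψ.1.1‖ 0 with h0 | h0
  · obtain ⟨x, hx⟩ := hlx v
    rw [hx, norm_eq_zero.1 h0]
    simp
  · have h1 := ContinuousLinearMap.le_of_opNorm_le _ (hC ψ) v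
    rw [smul_apply, norm_smul, RCLike.norm_ofReal,
      abs_of_nonneg (by positivity), inv_mul_le_iff₀ (by positivity)] at h1
    linarith

/-- Density of `D(A*)` allows testing with `y` itself. -/
theorem norm_le_of_forall_inner_DAdj {y : X} {R : ℝ} (hR : 0 ≤ R)
    (h : ∀ ψ : S.DAdj, ‖(inner 𝕜 ψ.1.1 y : 𝕜)‖ ≤ R * ‖ψ.1.1‖) : ‖y‖ ≤ R := by
  have h1 : ‖(inner 𝕜 y y : 𝕜)‖ ≤ R * ‖y‖ := by
    refine isClosed_property (p := fun z : X => ‖(inner 𝕜 z y : 𝕜)‖ ≤ R * ‖z‖)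
      S.dense_fst_DAdj ?_ h y
    exact isClosed_le (continuous_id.inner continuous_const).norm (by fun_prop)
  rw [inner_self_eq_norm_sq_to_K, norm_pow, RCLike.norm_ofReal, abs_norm, sq] at h1
  rcases (norm_nonneg y).eq_or_lt with h0 | h0
  · rwa [← h0]
  · exact le_of_mul_le_mul_right h1 h0

end ControlMaps

/-! ### Bounded dependence of the state on the control. -/

section Estimate

variable {𝕜 X U : Type*} [RCLike 𝕜]
  [NormedAddCommGroup X] [InnerProductSpace 𝕜 X] [CompleteSpace X]
  [NormedAddCommGroup U] [InnerProductSpace 𝕜 U]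
  {S : C0Semigroup 𝕜 X} {B : U →L[𝕜] S.Xminus}

/-- The admissibility estimate, transported to any window of length at most `τ`. -/
theorem norm_integral_window_le {τ C : ℝ} (hτ : 0 < τ) (hC0 : 0 ≤ C)
    (hC : ∀ (v : L2 0 τ U) (ψ : S.DAdj),
      ‖∫ s in (0 : ℝ)..τ, B (v s) (S.adjFlow (τ - s).toNNReal ψ)‖ ≤ C * ‖v‖ * ‖ψ.1.1‖)
    {T : ℝ} (u : L2 0 T U) {t : ℝ} (ht : t ∈ Set.Icc 0 T) (ψ : S.DAdj) :
    ‖∫ s in (max (t - τ) 0)..t, B (u s) (S.adjFlow (t - s).toNNReal ψ)‖ ≤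
      C * ‖u‖ * ‖ψ.1.1‖ := by
  -- For `t < τ` the window starts before time `0`, where the extended control vanishes; hence the
  -- lower limit `max (t - τ) 0`.
  obtain ⟨v, hv, hvu⟩ := exists_shift u τ (t - τ)
  have e : ∫ s in (max (t - τ) 0)..t, B (u s) (S.adjFlow (t - s).toNNReal ψ) =
      ∫ s in (0 : ℝ)..τ, B (v s) (S.adjFlow (τ - s).toNNReal ψ) := by
    have e1 : ∫ s in (0 : ℝ)..τ, B (v s) (S.adjFlow (τ - s).toNNReal ψ) =
        ∫ s in (0 : ℝ)..τ, B ((Set.Ioc 0 T).indicator u (s + (t - τ)))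
          (S.adjFlow (t - (s + (t - τ))).toNNReal ψ) := by
      refine intervalIntegral.integral_congr_ae ?_
      filter_upwards [(ae_restrict_iff' measurableSet_Ioc).1 hvu] with s hs hst
      rw [Set.uIoc_of_le hτ.le] at hst
      rw [hs hst]
      congr 3
      ring
    have e2 : ∀ s, B ((Set.Ioc 0 T).indicator u s) (S.adjFlow (t - s).toNNReal ψ) =
        (Set.Ioc 0 T).indicator (fun s => B (u s) (S.adjFlow (t - s).toNNReal ψ)) s := by
      intro s
      by_cases hs : s ∈ Set.Ioc 0 T
      · simp only [Set.indicator_of_mem hs]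
      · simp only [Set.indicator_of_notMem hs, map_zero, zero_apply]
    rw [e1, intervalIntegral.integral_comp_add_right
      (fun s => B ((Set.Ioc 0 T).indicator u s) (S.adjFlow (t - s).toNNReal ψ)) (t - τ)]
    simp only [e2]
    rw [zero_add, add_sub_cancel,
      intervalIntegral.integral_of_le (a := t - τ) (b := t) (by linarith),
      setIntegral_indicator measurableSet_Ioc, Set.Ioc_inter_Ioc,
      intervalIntegral.integral_of_le (max_le (by linarith) ht.1), min_eq_left ht.2]
  rw [e]
  refine (hC v ψ).trans ?_
  gcongr

/-- Solutions with zero initial value depend boundedly on the control. -/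
theorem Admissible.exists_norm_solution_le [CompleteSpace U] (hB : Admissible S B) (T : ℝ) :
    ∃ R : ℝ, 0 ≤ R ∧ ∀ (u : L2 0 T U) (x : C(Set.Icc (0 : ℝ) T, X)),
      IsSolution S B 0 u x → ‖x‖ ≤ R * ‖u‖ := by
  obtain ⟨τ, hτ, C, hC0, hC⟩ := hB.exists_norm_integral_le
  obtain ⟨M, hM0, hM⟩ := S.exists_norm_toFun_le τ.toNNReal
  -- Induction over windows of length `τ`: variation of constants from `max (t - τ) 0` to `t`
  -- replaces the bound `R` by `M * R + C`.
  have step : ∀ n : ℕ, ∃ R : ℝ, 0 ≤ R ∧ ∀ (u : L2 0 T U) (x : C(Set.Icc (0 : ℝ) T, X)),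
      IsSolution S B 0 u x → ∀ t ∈ Set.Icc 0 T, t ≤ n * τ → ‖ext x t‖ ≤ R * ‖u‖ := by
    intro n
    induction n with
    | zero =>
      refine ⟨0, le_rfl, fun u x hx t ht htn => ?_⟩
      have h0 : t = 0 := le_antisymm (by simpa using htn) ht.1
      subst h0
      have : ext x 0 = 0 := S.eq_zero_of_forall_inner_DAdj fun ψ => by
        have := hx ⟨0, ht⟩ ψ
        rw [← ext_coe x] at this
        simpa using this
      simp [this]
    | succ n ih =>
      obtain ⟨R, hR0, hR⟩ := ih
      refine ⟨M * R + C, by positivity, fun u x hx t ht htn => ?_⟩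
      have ha : max (t - τ) 0 ∈ Set.Icc 0 T :=
        ⟨le_max_right _ _, max_le (by linarith [ht.2]) (ht.1.trans ht.2)⟩
      have hat : max (t - τ) 0 ≤ t := max_le (by linarith) ht.1
      have h1 := hR u x hx _ ha (max_le (by push_cast at htn; linarith) (by positivity))
      refine norm_le_of_forall_inner_DAdj (S := S) (by positivity) fun ψ => ?_
      rw [hx.inner_eq_flow_add_integral ha ht hat ψ]
      have h2 : ‖S.toFun (t - max (t - τ) 0).toNNReal‖ ≤ M :=
        hM _ (Real.toNNReal_le_toNNReal (by linarith [le_max_left (t - τ) 0]))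
      calc _ ≤ M * ‖ψ.1.1‖ * (R * ‖u‖) + C * ‖u‖ * ‖ψ.1.1‖ := by
            refine (norm_add_le _ _).trans (add_le_add ((norm_inner_le_norm _ _).trans ?_)
              (norm_integral_window_le hτ hC0 hC u ht ψ))
            gcongr
            exact S.norm_adjFlow_fst_le ψ h2
        _ = (M * R + C) * ‖u‖ * ‖ψ.1.1‖ := by ring
  obtain ⟨n, hn⟩ := exists_nat_ge (T / τ)
  obtain ⟨R, hR0, hR⟩ := step n
  refine ⟨R, hR0, fun u x hx => (ContinuousMap.norm_le _ (by positivity)).2 fun t => ?_⟩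
  rw [← ext_coe x]
  exact hR u x hx t t.2 (t.2.2.trans ((div_le_iff₀ hτ).1 hn))

end Estimate

/-! ### Exact penalisation, uniqueness and existence of optimal controls. -/

section Optimality

variable {𝕜 X U Z : Type*} [RCLike 𝕜]
  [NormedAddCommGroup X] [InnerProductSpace 𝕜 X] [CompleteSpace X]
  [NormedAddCommGroup U] [InnerProductSpace 𝕜 U]
  [NormedAddCommGroup Z] [InnerProductSpace 𝕜 Z]
  {S : C0Semigroup 𝕜 X} {B : U →L[𝕜] S.Xminus} {t₀ T : ℝ} {Pi : L2 0 T X →ₗ[𝕜] L2 t₀ T Z}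
  {C₁ γ : ℝ} {x₀ x_d : X} {u_d : U}

theorem le_mul_of_forall_quadratic {a b c : ℝ}
    (h : ∀ ε : ℝ, 0 < ε → ε ≤ 1 → ε * a ≤ ε * b + ε ^ 2 * c) : a ≤ b := by
  have hlim : Tendsto (fun ε : ℝ => b + ε * c) (𝓝[>] 0) (𝓝 b) :=
    (Continuous.tendsto' (by fun_prop) 0 b (by simp)).mono_left nhdsWithin_le_nhds
  refine ge_of_tendsto hlim ?_
  filter_upwards [Ioc_mem_nhdsGT (zero_lt_one' ℝ)] with ε hε
  have := h ε hε.1 hε.2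
  refine le_of_mul_le_mul_left ?_ hε.1
  linarith

/-- Exactness of the penalty: optimal states reach the desired profile. -/
theorem IsOptimal.profile_eq (hctrl : NodalProfileExactlyControllable S B Pi C₁) (hC₁ : 0 < C₁)
    {u_exact : L2 0 T U} {x_exact : C(Set.Icc (0 : ℝ) T, X)}
    (hexact : IsSolution S B x₀ u_exact x_exact)
    (hprofile : Pi (stateL2 x_exact) = Pi (constL2 0 T x_d))
    (hγ : C₁ * ‖u_exact - constL2 0 T u_d‖ < γ)
    {p : L2 0 T U × C(Set.Icc (0 : ℝ) T, X)} (hp : IsOptimal S B Pi γ x₀ x_d u_d p) :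
    Pi (stateL2 p.2) = Pi (constL2 0 T x_d) := by
  obtain ⟨hsol, hmin⟩ := hp
  set e := Pi (stateL2 p.2) - Pi (constL2 0 T x_d) with he
  set d := p.1 - constL2 0 T u_d with hd
  have hγ0 : 0 < γ := lt_of_le_of_lt (by positivity) hγ
  have h1 := hmin _ _ hexact
  simp only [cost, hprofile, sub_self, norm_zero, mul_zero, add_zero, ← he, ← hd] at h1
  have h2 : ‖d‖ ≤ ‖u_exact - constL2 0 T u_d‖ := by
    refine le_of_sq_le_sq ?_ (norm_nonneg _)
    have := mul_nonneg hγ0.le (norm_nonneg e)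
    linarith
  obtain ⟨v, y, hy, hPy, hv⟩ := hctrl 0 (-e)
  rw [norm_zero, zero_add, norm_neg] at hv
  -- First-order optimality in the direction `v`, along which the profile defect is `(1 - ε) e`.
  have h3 : γ * ‖e‖ ≤ ‖d‖ * ‖v‖ := by
    refine le_mul_of_forall_quadratic (c := 1 / 2 * ‖v‖ ^ 2) fun ε hε hε1 => ?_
    have h4 := hmin _ _ (hsol.add_smul hy (ε : 𝕜))
    have e1 : p.1 + (ε : 𝕜) • v - constL2 0 T u_d = d + (ε : 𝕜) • v := by
      rw [hd]
      abel
    have e2 : Pi (stateL2 (p.2 + (ε : 𝕜) • y)) - Pi (constL2 0 T x_d) =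
        ((1 - ε : ℝ) : 𝕜) • e := by
      rw [stateL2_add_smul, map_add, map_smul, hPy, add_sub_right_comm, ← he, smul_neg,
        RCLike.ofReal_sub, sub_smul, RCLike.ofReal_one, one_smul, sub_eq_add_neg]
    simp only [cost, e1, e2, ← he, ← hd] at h4
    have n1 : ‖((1 - ε : ℝ) : 𝕜) • e‖ = (1 - ε) * ‖e‖ := by
      rw [norm_smul, RCLike.norm_ofReal, abs_of_nonneg (by linarith)]
    have n2 : ‖d + (ε : 𝕜) • v‖ ^ 2 ≤ (‖d‖ + ε * ‖v‖) ^ 2 := by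
      refine pow_le_pow_left₀ (norm_nonneg _) ((norm_add_le _ _).trans_eq ?_) 2
      rw [norm_smul, RCLike.norm_ofReal, abs_of_pos hε]
    rw [n1] at h4
    linarith
  by_contra hne
  have hepos : 0 < ‖e‖ := norm_pos_iff.2 (sub_ne_zero.2 hne)
  have h5 : γ * ‖e‖ ≤ (C₁ * ‖u_exact - constL2 0 T u_d‖) * ‖e‖ := by
    calc γ * ‖e‖ ≤ ‖d‖ * ‖v‖ := h3
      _ ≤ ‖u_exact - constL2 0 T u_d‖ * (C₁ * ‖e‖) := by gcongr
      _ = _ := by ring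
  exact absurd (le_of_mul_le_mul_right h5 hepos) (not_le.2 hγ)

/-- The penalty vanishes at both pairs and at their midpoint, so the parallelogram law leaves no
room for two distinct minimisers. -/
theorem IsOptimal.control_eq {p q : L2 0 T U × C(Set.Icc (0 : ℝ) T, X)}
    (hp : IsOptimal S B Pi γ x₀ x_d u_d p) (hq : IsOptimal S B Pi γ x₀ x_d u_d q)
    (hPp : Pi (stateL2 p.2) = Pi (constL2 0 T x_d))
    (hPq : Pi (stateL2 q.2) = Pi (constL2 0 T x_d)) : p.1 = q.1 := by
  have hy := hq.1.sub hp.1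
  have h1 := hp.2 _ _ hq.1
  have h2 := hq.2 _ _ hp.1
  have h3 := hp.2 _ _ (hp.1.add_smul hy ((1 / 2 : ℝ) : 𝕜))
  have e2 : Pi (stateL2 (p.2 + ((1 / 2 : ℝ) : 𝕜) • (q.2 - p.2))) = Pi (constL2 0 T x_d) := by
    have e3 : Pi (stateL2 (p.2 + (1 : 𝕜) • (q.2 - p.2))) = Pi (constL2 0 T x_d) := by
      rw [one_smul, add_sub_cancel, hPq]
    rw [stateL2_add_smul, map_add, hPp, one_smul, add_eq_left] at e3
    rw [stateL2_add_smul, map_add, map_smul, hPp, e3, smul_zero, add_zero]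
  have e1 : p.1 + ((1 / 2 : ℝ) : 𝕜) • (q.1 - p.1) - constL2 0 T u_d =
      ((1 / 2 : ℝ) : 𝕜) • ((p.1 - constL2 0 T u_d) + (q.1 - constL2 0 T u_d)) := by
    have : p.1 = ((1 / 2 : ℝ) : 𝕜) • p.1 + ((1 / 2 : ℝ) : 𝕜) • p.1 := by
      rw [← _root_.add_smul, ← RCLike.ofReal_add]
      norm_num
    have hc : constL2 0 T u_d =
        ((1 / 2 : ℝ) : 𝕜) • constL2 0 T u_d + ((1 / 2 : ℝ) : 𝕜) • constL2 0 T u_d := by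
      rw [← _root_.add_smul, ← RCLike.ofReal_add]
      norm_num
    nth_rewrite 1 [this]
    nth_rewrite 1 [hc]
    simp only [smul_sub, smul_add]
    abel
  simp only [cost, hPp, hPq, e2, e1, sub_self, norm_zero, mul_zero, add_zero] at h1 h2 h3
  rw [norm_smul, RCLike.norm_ofReal, abs_of_pos (by norm_num : (0 : ℝ) < 1 / 2)] at h3
  have hpar := parallelogram_law_with_norm 𝕜 (p.1 - constL2 0 T u_d) (q.1 - constL2 0 T u_d)
  rw [sub_sub_sub_cancel_right] at hpar
  have h4 : ‖p.1 - q.1‖ ^ 2 ≤ 0 := by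
    nlinarith
  have h5 : ‖p.1 - q.1‖ = 0 := pow_eq_zero_iff two_ne_zero |>.1 (le_antisymm h4 (sq_nonneg _))
  exact sub_eq_zero.1 (norm_eq_zero.1 h5)

/-- The controls which steer `x₀` to the desired profile form a closed set. -/
theorem isClosed_exactControls [CompleteSpace U] (hB : Admissible S B)
    (hbdd : ControlToProfileBounded S B Pi) (z : L2 t₀ T Z) :
    IsClosed {u : L2 0 T U | ∃ x, IsSolution S B x₀ u x ∧ Pi (stateL2 x) = z} := by
  obtain ⟨R, hR0, hR⟩ := hB.exists_norm_solution_le T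
  obtain ⟨C, hC⟩ := hbdd
  refine IsSeqClosed.isClosed fun w u hw hlim => ?_
  choose x hx hPx using hw
  have hcauchy : CauchySeq x := by
    have h1 := cauchySeq_iff_tendsto_dist_atTop_0.1 hlim.cauchySeq
    refine cauchySeq_iff_tendsto_dist_atTop_0.2 (squeeze_zero (fun _ => dist_nonneg) (fun n => ?_)
      (by simpa using h1.const_mul R))
    rw [dist_eq_norm, dist_eq_norm]
    exact hR _ _ ((hx n.1).sub (hx n.2))
  obtain ⟨y, hy⟩ := cauchySeq_tendsto_of_complete hcauchy
  have hsol : IsSolution S B x₀ u y := IsSolution.of_tendsto hx hlim hy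
  refine ⟨y, hsol, ?_⟩
  -- `Pi` may be unbounded, so convergence of the states is not enough; the control-to-profile bound
  -- is applied to the difference of two solutions, which starts at zero.
  have hbound : ∀ n, ‖Pi (stateL2 y) - z‖ ≤ C * ‖u - w n‖ := fun n => by
    have h1 := hC _ _ (hsol.sub (hx n))
    have h2 : stateL2 y = stateL2 (x n) + (1 : 𝕜) • stateL2 (y - x n) := by
      rw [← stateL2_add_smul, one_smul, add_sub_cancel]
    rwa [h2, one_smul, map_add, hPx n, add_sub_cancel_left]
  have hzero : Tendsto (fun n => C * ‖u - w n‖) atTop (𝓝 0) := by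
    have := ((tendsto_const_nhds (x := u)).sub hlim).norm.const_mul C
    simpa using this
  have h0 : ‖Pi (stateL2 y) - z‖ ≤ 0 := ge_of_tendsto' hzero hbound
  exact sub_eq_zero.1 (norm_le_zero_iff.1 h0)

theorem exists_isOptimal [CompleteSpace U] (hB : Admissible S B)
    (hctrl : NodalProfileExactlyControllable S B Pi C₁) (hC₁ : 0 < C₁)
    {u_exact : L2 0 T U} {x_exact : C(Set.Icc (0 : ℝ) T, X)}
    (hexact : IsSolution S B x₀ u_exact x_exact)
    (hprofile : Pi (stateL2 x_exact) = Pi (constL2 0 T x_d))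
    (hγ : C₁ * ‖u_exact - constL2 0 T u_d‖ < γ) (hbdd : ControlToProfileBounded S B Pi) :
    ∃ p, IsOptimal S B Pi γ x₀ x_d u_d p := by
  obtain ⟨u, ⟨x, hx, hPx⟩, hmin⟩ := exists_forall_norm_sub_le (𝕜 := 𝕜)
    (K := {u : L2 0 T U | ∃ x, IsSolution S B x₀ u x ∧
      Pi (stateL2 x) = Pi (constL2 0 T x_d)})
    ⟨u_exact, x_exact, hexact, hprofile⟩ (isClosed_exactControls hB hbdd _) (by
      rintro u ⟨x, hx, hPx⟩ v ⟨y, hy, hPy⟩ c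
      refine ⟨x + c • (y - x), hx.add_smul (hy.sub hx) c, ?_⟩
      have e : Pi (stateL2 (x + (1 : 𝕜) • (y - x))) = Pi (constL2 0 T x_d) := by
        rw [one_smul, add_sub_cancel, hPy]
      rw [stateL2_add_smul, map_add, hPx, one_smul, add_eq_left] at e
      rw [stateL2_add_smul, map_add, map_smul, hPx, e, smul_zero, add_zero])
    (constL2 0 T u_d)
  refine ⟨(u, x), hx, fun v y hy => ?_⟩
  set e := Pi (stateL2 y) - Pi (constL2 0 T x_d) with he
  obtain ⟨w, η, hη, hPη, hw⟩ := hctrl 0 (-e)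
  rw [norm_zero, zero_add, norm_neg] at hw
  -- Any competitor becomes an exact control after a correction of norm at most `C₁ ‖e‖`.
  have h1 := hmin (v + (1 : 𝕜) • w) ⟨_, hy.add_smul hη 1, by
    rw [stateL2_add_smul, map_add, one_smul, hPη, he]
    abel⟩
  have h2 : ‖v + (1 : 𝕜) • w - constL2 0 T u_d‖ ≤ ‖v - constL2 0 T u_d‖ + C₁ * ‖e‖ := by
    rw [one_smul, add_sub_right_comm]
    exact (norm_add_le _ _).trans (by gcongr)
  have h3 : C₁ * ‖u - constL2 0 T u_d‖ ≤ γ :=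
    (mul_le_mul_of_nonneg_left (hmin u_exact ⟨x_exact, hexact, hprofile⟩) hC₁.le).trans hγ.le
  simp only [cost, hPx, sub_self, norm_zero, mul_zero, add_zero, ← he]
  have h4 : C₁ * ‖u - constL2 0 T u_d‖ * ‖e‖ ≤ γ * ‖e‖ := by gcongr
  have h5 := mul_le_mul_of_nonneg_left (h1.trans h2) (norm_nonneg (u - constL2 0 T u_d))
  -- With `a`, `b` the distances of `u`, `v` from `u_d`: `a² ≤ a b + C₁ a ‖e‖ ≤ (a² + b²) / 2 + γ
  -- ‖e‖`.
  nlinarith [sq_nonneg (‖u - constL2 0 T u_d‖ - ‖v - constL2 0 T u_d‖)]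

end Optimality

end NodalControl

theorem mainTheorem5 {𝕜 X U Z : Type*} [RCLike 𝕜]
    [NormedAddCommGroup X] [InnerProductSpace 𝕜 X] [CompleteSpace X]
    [NormedAddCommGroup U] [InnerProductSpace 𝕜 U] [CompleteSpace U]
    [NormedAddCommGroup Z] [InnerProductSpace 𝕜 Z] [CompleteSpace Z]
    (S : NodalControl.C0Semigroup 𝕜 X) (B : U →L[𝕜] S.Xminus)
    (hB : NodalControl.Admissible S B)
    (t₀ T : ℝ) (ht₀ : 0 < t₀) (hT : t₀ < T)
    (Pi : NodalControl.L2 0 T X →ₗ[𝕜] NodalControl.L2 t₀ T Z)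
    (C₁ : ℝ) (hC₁ : 0 < C₁)
    (hctrl : NodalControl.NodalProfileExactlyControllable S B Pi C₁)
    (x₀ x_d : X) (u_d : U)
    (u_exact : NodalControl.L2 0 T U) (x_exact : C(Set.Icc (0 : ℝ) T, X))
    (hexact : NodalControl.IsSolution S B x₀ u_exact x_exact)
    (hprofile : Pi (NodalControl.stateL2 x_exact) = Pi (NodalControl.constL2 0 T x_d))
    (γ : ℝ) (hγ : C₁ * ‖u_exact - NodalControl.constL2 0 T u_d‖ < γ) :
    (∀ p, NodalControl.IsOptimal S B Pi γ x₀ x_d u_d p →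
      ∀ᵐ s ∂(volume.restrict (Set.Ioc t₀ T)),
        Pi (NodalControl.stateL2 p.2) s = Pi (NodalControl.constL2 0 T x_d) s) ∧
    (∀ p q, NodalControl.IsOptimal S B Pi γ x₀ x_d u_d p →
      NodalControl.IsOptimal S B Pi γ x₀ x_d u_d q → p = q) ∧
    (NodalControl.ControlToProfileBounded S B Pi →
      ∃ p, NodalControl.IsOptimal S B Pi γ x₀ x_d u_d p) := by

  refine ⟨fun p hp => ?_, fun p q hp hq => ?_, fun hbdd => ?_⟩
  · rw [hp.profile_eq hctrl hC₁ hexact hprofile hγ]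
    exact Eventually.of_forall fun _ => rfl
  · have h1 : p.1 = q.1 := hp.control_eq hq
      (hp.profile_eq hctrl hC₁ hexact hprofile hγ) (hq.profile_eq hctrl hC₁ hexact hprofile hγ)
    obtain ⟨R, -, hR⟩ := hB.exists_norm_solution_le T
    have h2 := hR _ _ (hp.1.sub hq.1)
    rw [h1, sub_self, norm_zero, mul_zero] at h2
    exact Prod.ext h1 (sub_eq_zero.1 (norm_le_zero_iff.1 h2))
  · exact NodalControl.exists_isOptimal hB hctrl hC₁ hexact hprofile hγ hbdd
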